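/- For $k\ge 1$ let $\mathbb{B}^k$ be the open unit ball of $\mathbb{R}^k$ and $|\cdot|$ the Euclidean norm. A $C^2$ function $u:\mathbb{B}^n\to\mathbb{R}$ is called hyperbolic harmonic if $$(1-|x|^2)^2\,\Delta u(x)+2(n-2)(1-|x|^2)\sum_{i=1}^n x_i\,\frac{\partial u}{\partial x_i}(x)=0\qquad\text{for all }x\in\mathbb{B}^n,$$ and a map $h:\mathbb{B}^n\to\mathbb{R}^m$ is called harmonic (resp. hyperbolic harmonic) if each of its components is. For $h:\mathbb{B}^n\to\mathbb{R}^m$ and $x\in\mathbb{B}^n$ put $$\bigl|\nabla|h|(x)\bigr|=\sup_{\beta\in\mathbb{R}^n,\ |\beta|=1}\ \lim_{t\to0^+}\frac{\bigl|\,|h(x+t\beta)|-|h(x)|\,\bigr|}{t}.$$ Let $n\ge 3$, $m\ge 1$, and let $h:\mathbb{B}^n\to\mathbb{B}^m$ be harmonic or hyperbolic harmonic. Then for every $x\in\mathbb{B}^n$ the limits above exist, their supremum is finite, and $$\bigl|\nabla|h|(x)\bigr|\le\begin{cases}\dfrac n2\,\dfrac{1-|h(x)|^2}{1-|x|}&\text{if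 }h\text{ is harmonic},\\[2ex](n-1)\,\dfrac{1-|h(x)|^2}{1-|x|^2}&\text{if }h\text{ is hyperbolic harmonic}.\end{cases}$$ Moreover, if $n\ge 4$, then both inequalities are strict at every $x\in\mathbb{B}^n$. -/

import Mathlib

open Metric Filter Topology InnerProductSpace

/-- `hypLaplacian u x` is
`(1 - |x|^2)^2 Δu(x) + 2 (n - 2) (1 - |x|^2) ∑ i, x_i ∂u/∂x_i (x)`,
for `u` with values in a real normed space (the Laplacian acts on each component of `u`). -/
noncomputable def hypLaplacian {n : ℕ} {F : Type*} [NormedAddCommGroup F] [NormedSpace ℝ F]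
    (u : EuclideanSpace ℝ (Fin n) → F) (x : EuclideanSpace ℝ (Fin n)) : F :=
  (1 - ‖x‖ ^ 2) ^ 2 • Laplacian.laplacian u x +
    (2 * ((n : ℝ) - 2) * (1 - ‖x‖ ^ 2)) •
      ∑ i : Fin n, x i • fderiv ℝ u x (EuclideanSpace.single i (1 : ℝ))

/-- `u` is a `C^2` solution of `hypLaplacian u = 0` on the open unit ball. -/
def IsHyperbolicHarmonic {n : ℕ} {F : Type*} [NormedAddCommGroup F] [NormedSpace ℝ F]
    (u : EuclideanSpace ℝ (Fin n) → F) : Prop :=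
  ContDiffOn ℝ 2 u (ball 0 1) ∧ ∀ x ∈ ball (0 : EuclideanSpace ℝ (Fin n)) 1, hypLaplacian u x = 0

/-- `IsGradNorm u x L` says that `|∇u(x)|` exists and equals `L`, where
`|∇u(x)| = sup_{|β| = 1} lim_{t → 0+} |u (x + t β) - u x| / t`:
the limit exists for every unit vector `β`, and the least upper bound of the limits is `L`. -/
def IsGradNorm {n : ℕ} (u : EuclideanSpace ℝ (Fin n) → ℝ) (x : EuclideanSpace ℝ (Fin n))
    (L : ℝ) : Prop :=
  ∃ d : sphere (0 : EuclideanSpace ℝ (Fin n)) 1 → ℝ,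
    (∀ β : sphere (0 : EuclideanSpace ℝ (Fin n)) 1,
      Tendsto (fun t : ℝ => |u (x + t • (β : EuclideanSpace ℝ (Fin n))) - u x| / t)
        (𝓝[>] 0) (𝓝 (d β))) ∧
    IsLUB (Set.range d) L

/-! Testing `h` against unit vectors reduces everything to scalar solutions `u = ⟨e, h⟩` with `|u| <
1`. If `h x ≠ 0`, then `|∇|h||` at `x` is the norm of the derivative of `⟨e, h⟩` with `e = h x / |h
x|`, and `⟨e, h x⟩ = |h x|`. If `h x = 0`, it is the operator norm of `Dh`, and `e` is taken along a
maximal value of `Dh`. So a bound `D_β u ≤ B (1 - u²)` at `x` is enough (`exists_isGradNorm_le`).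
The point `x` is then moved to the origin, by `y ↦ x + (1 - |x|) y` for harmonic functions and by a
hyperbolic reflection for hyperbolic harmonic ones.

At the origin both equations read `Δv + b(|x|) x·∇v = 0` with `b ≥ 0`. The first angular moment
`M(r) = ∫ ⟨e, η⟩ v(rη)` over the unit sphere satisfies a second order linear ODE, and an adjoint
pair `p, q` makes `p M' + q M` constant, equal to `D_e v(0)` (`IsUniformOnSphere.fderiv_center_eq`).
Since `p` vanishes at `1` and `q → κ` there, boundedness of `M` forces `D_e v(0) ≤ κ sup M`
(`le_mul_of_singular_ode`).

To bound `M`, the mean value property `∫ v(rη) = v(0)` gives `M(r) + v(0)² = ∫ (⟨e, η⟩ + v(0)) v(rη)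
≤ ∫ |⟨e, η⟩ + v(0)|`. On the sphere of `ℝ³` a coordinate is uniform on `[-1, 1]`, so this integral
is `(1 + v(0)²) / 2`. In higher dimension the law is more concentrated and the integral is strictly
smaller (`IsUniformOnSphere.exists_integral_abs_inner_sub_le`). Hence `D_e v(0) ≤ (κ/2)(1 - v(0)²)`,
strictly from dimension 4 on, with `κ = n` in the harmonic case and `κ = 2(n - 1)` in the hyperbolic
one. -/

open MeasureTheory Module

/-! ### The uniform probability measure on the sphere. -/

section SphereMeasure

variable {E : Type*} [NormedAddCommGroup E] [InnerProductSpace ℝ E] [MeasurableSpace E]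

/-- `μ` is the rotation invariant probability measure on the unit sphere of `E`, seen as a measure
on `E`. -/
structure IsUniformOnSphere (μ : Measure E) : Prop where
  isProbabilityMeasure : IsProbabilityMeasure μ
  restrict_sphere : μ.restrict (sphere 0 1) = μ
  measurePreserving : ∀ g : E ≃ₗᵢ[ℝ] E, MeasurePreserving g μ μ

-- Normalized Lebesgue measure on the ball is rotation invariant, and the radial projection `x ↦ x /
-- |x|` commutes with rotations, so the image measure inherits the invariance.
variable (E) in
theorem exists_isUniformOnSphere [BorelSpace E] [FiniteDimensional ℝ E] [Nontrivial E] :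
    ∃ μ : Measure E, IsUniformOnSphere μ := by
  set ν : Measure E := ProbabilityTheory.cond volume (ball 0 1) with hν
  have hνp : IsProbabilityMeasure ν :=
    ProbabilityTheory.cond_isProbabilityMeasure_of_finite (measure_ball_pos _ _ one_pos).ne'
      measure_ball_lt_top.ne
  set T : E → E := fun x => ‖x‖⁻¹ • x with hT
  have hTm : Measurable T := by fun_prop
  refine ⟨ν.map T, Measure.isProbabilityMeasure_map hTm.aemeasurable, ?_, ?_⟩
  · refine Measure.restrict_eq_self_of_ae_mem ?_
    refine (ae_map_iff (p := (· ∈ sphere (0 : E) 1)) hTm.aemeasurable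
      isClosed_sphere.measurableSet).2 ?_
    have h0 : ∀ᵐ x ∂(volume : Measure E), x ≠ 0 := by
      simp [ae_iff]
    have h1 : ∀ᵐ x ∂ν, x ≠ 0 := (ProbabilityTheory.cond_absolutelyContinuous).ae_le h0
    filter_upwards [h1] with x hx
    simp [hT, norm_smul, hx]
  · intro g
    have hg : MeasurePreserving g ν ν := by
      have h := (g.measurePreserving (E := E)).restrict_preimage
        (measurableSet_ball (x := (0 : E)) (ε := 1))
      have hp : g ⁻¹' ball (0 : E) 1 = ball 0 1 := by
        ext x; simp
      rw [hp] at h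
      exact h.smul_measure _
    refine ⟨g.continuous.measurable, ?_⟩
    rw [Measure.map_map g.continuous.measurable hTm]
    have : g ∘ T = T ∘ g := by
      ext x; simp [hT]
    rw [this, ← Measure.map_map hTm g.continuous.measurable, hg.map_eq]

variable {μ : Measure E}

theorem IsUniformOnSphere.ae_mem (hμ : IsUniformOnSphere μ) [BorelSpace E] :
    ∀ᵐ η ∂μ, η ∈ sphere (0 : E) 1 := by
  have := ae_restrict_mem (μ := μ) (isClosed_sphere (x := (0 : E)) (ε := 1)).measurableSet
  rwa [hμ.restrict_sphere] at this

theorem IsUniformOnSphere.integrable [BorelSpace E] [FiniteDimensional ℝ E]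
    (hμ : IsUniformOnSphere μ) {F : Type*} [NormedAddCommGroup F] {f : E → F}
    (hf : ContinuousOn f (sphere 0 1)) : Integrable f μ := by
  have := hμ.isProbabilityMeasure
  have h := hf.integrableOn_compact (μ := μ) (isCompact_sphere 0 1)
  rwa [IntegrableOn, hμ.restrict_sphere] at h

theorem IsUniformOnSphere.integral_congr [BorelSpace E]
    (hμ : IsUniformOnSphere μ) {F : Type*} [NormedAddCommGroup F] [NormedSpace ℝ F] {f g : E → F}
    (h : ∀ η ∈ sphere (0 : E) 1, f η = g η) : ∫ η, f η ∂μ = ∫ η, g η ∂μ :=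
  integral_congr_ae (hμ.ae_mem.mono h)

theorem IsUniformOnSphere.integral_mono [BorelSpace E] [FiniteDimensional ℝ E]
    (hμ : IsUniformOnSphere μ) {f g : E → ℝ}
    (hf : ContinuousOn f (sphere 0 1)) (hg : ContinuousOn g (sphere 0 1))
    (h : ∀ η ∈ sphere (0 : E) 1, f η ≤ g η) : ∫ η, f η ∂μ ≤ ∫ η, g η ∂μ :=
  integral_mono_ae (hμ.integrable hf) (hμ.integrable hg) (hμ.ae_mem.mono h)

/-- Differentiation under the integral sign over the sphere. -/
theorem IsUniformOnSphere.hasDerivAt_integral [BorelSpace E] [FiniteDimensional ℝ E]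
    (hμ : IsUniformOnSphere μ) {F F' : ℝ → E → ℝ} {t₀ ε : ℝ} (hε : 0 < ε)
    (hF : ∀ t ∈ closedBall t₀ ε, ContinuousOn (F t) (sphere 0 1))
    (hd : ∀ t ∈ closedBall t₀ ε, ∀ η ∈ sphere (0 : E) 1, HasDerivAt (F · η) (F' t η) t)
    (hF' : ContinuousOn (fun z : ℝ × E => F' z.1 z.2) (closedBall t₀ ε ×ˢ sphere 0 1)) :
    HasDerivAt (fun t => ∫ η, F t η ∂μ) (∫ η, F' t₀ η ∂μ) t₀ := by
  have := hμ.isProbabilityMeasure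
  obtain ⟨C, hC⟩ := ((isCompact_closedBall t₀ ε).prod
    (isCompact_sphere (0 : E) 1)).exists_bound_of_continuousOn hF'
  have ht₀ : t₀ ∈ closedBall t₀ ε := mem_closedBall_self hε.le
  have hF'0 : ContinuousOn (F' t₀) (sphere 0 1) :=
    hF'.comp (f := fun η => (t₀, η)) (by fun_prop) fun η hη => ⟨ht₀, hη⟩
  refine (hasDerivAt_integral_of_dominated_loc_of_deriv_le (bound := fun _ => C)
    (closedBall_mem_nhds t₀ hε) ?_ (hμ.integrable (hF t₀ ht₀))
    (hμ.integrable hF'0).aestronglyMeasurable ?_ (integrable_const C) ?_).2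
  · filter_upwards [closedBall_mem_nhds t₀ hε] with t ht
    exact (hμ.integrable (hF t ht)).aestronglyMeasurable
  · filter_upwards [hμ.ae_mem] with η hη t ht
    exact hC (t, η) ⟨ht, hη⟩
  · filter_upwards [hμ.ae_mem] with η hη t ht
    exact hd t ht η hη

end SphereMeasure

/-! ### Integration by parts on the sphere, from rotation invariance. -/

section Rotation

variable {E : Type*} [NormedAddCommGroup E] [InnerProductSpace ℝ E]

/-- The linear map rotating the plane of `a`, `b` by the angle `t`, for orthonormal `a`, `b`. -/
noncomputable def planeRotation (a b : E) (t : ℝ) : E →L[ℝ] E :=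
  ContinuousLinearMap.id ℝ E +
    ((Real.cos t - 1) • innerSL ℝ a - Real.sin t • innerSL ℝ b).smulRight a +
    (Real.sin t • innerSL ℝ a + (Real.cos t - 1) • innerSL ℝ b).smulRight b

theorem planeRotation_apply (a b : E) (t : ℝ) (x : E) :
    planeRotation a b t x = x +
      ((Real.cos t - 1) * inner ℝ a x - Real.sin t * inner ℝ b x) • a +
      (Real.sin t * inner ℝ a x + (Real.cos t - 1) * inner ℝ b x) • b := by
  simp [planeRotation]

theorem norm_planeRotation {a b : E} (ha : ‖a‖ = 1) (hb : ‖b‖ = 1) (hab : inner ℝ a b = 0)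
    (t : ℝ) (x : E) : ‖planeRotation a b t x‖ = ‖x‖ := by
  have hba : inner ℝ b a = 0 := by rw [real_inner_comm, hab]
  have haa : inner ℝ a a = (1 : ℝ) := by rw [real_inner_self_eq_norm_sq, ha]; norm_num
  have hbb : inner ℝ b b = (1 : ℝ) := by rw [real_inner_self_eq_norm_sq, hb]; norm_num
  have key : ‖planeRotation a b t x‖ ^ 2 = ‖x‖ ^ 2 := by
    rw [← real_inner_self_eq_norm_sq, ← real_inner_self_eq_norm_sq, planeRotation_apply]
    simp only [inner_add_left, inner_add_right, inner_smul_left, inner_smul_right, haa, hbb, hab,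
      hba, real_inner_comm a x, real_inner_comm b x, conj_trivial]
    linear_combination ((inner ℝ a x) ^ 2 + (inner ℝ b x) ^ 2) * Real.sin_sq_add_cos_sq t
  exact (sq_eq_sq₀ (norm_nonneg _) (norm_nonneg _)).1 key

theorem hasDerivAt_planeRotation (a b x : E) (t : ℝ) :
    HasDerivAt (fun t => planeRotation a b t x)
      ((-Real.sin t * inner ℝ a x - Real.cos t * inner ℝ b x) • a +
      (Real.cos t * inner ℝ a x - Real.sin t * inner ℝ b x) • b) t := by
  simp only [planeRotation_apply]
  have hc := (Real.hasDerivAt_cos t).sub_const 1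
  have hs := Real.hasDerivAt_sin t
  refine ((((hc.mul_const (inner ℝ a x)).sub (hs.mul_const (inner ℝ b x))).smul_const a).const_add
    x |>.add (((hs.mul_const (inner ℝ a x)).add (hc.mul_const (inner ℝ b x))).smul_const b)).congr_deriv ?_
  simp [sub_eq_add_neg]

variable [MeasurableSpace E] [BorelSpace E] [FiniteDimensional ℝ E] {μ : Measure E}

theorem IsUniformOnSphere.integral_comp_planeRotation (hμ : IsUniformOnSphere μ) {a b : E}
    (ha : ‖a‖ = 1) (hb : ‖b‖ = 1) (hab : inner ℝ a b = 0) (f : E → ℝ) (t : ℝ) :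
    ∫ η, f (planeRotation a b t η) ∂μ = ∫ η, f η ∂μ := by
  let g : E ≃ₗᵢ[ℝ] E := LinearIsometry.toLinearIsometryEquiv
    ⟨(planeRotation a b t : E →ₗ[ℝ] E), norm_planeRotation ha hb hab t⟩ rfl
  exact (hμ.measurePreserving g).integral_comp g.toHomeomorph.measurableEmbedding f

/-- The angular derivatives have mean value zero. -/
theorem IsUniformOnSphere.integral_angular_deriv (hμ : IsUniformOnSphere μ) {a b : E}
    (ha : ‖a‖ = 1) (hb : ‖b‖ = 1) (hab : inner ℝ a b = 0) {f : E → ℝ} {f' : E → E →L[ℝ] ℝ}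
    (hf : ∀ η ∈ sphere (0 : E) 1, HasFDerivAt f (f' η) η)
    (hf' : ContinuousOn f' (sphere 0 1)) :
    ∫ η, f' η (inner ℝ a η • b - inner ℝ b η • a) ∂μ = 0 := by
  have hmaps : ∀ t, Set.MapsTo (planeRotation a b t) (sphere 0 1) (sphere 0 1) := by
    intro t η hη
    simpa [norm_planeRotation ha hb hab] using hη
  have hcont : Continuous fun z : ℝ × E => planeRotation a b z.1 z.2 := by
    simp only [planeRotation_apply]; fun_prop
  have hfc : ContinuousOn f (sphere 0 1) := fun η hη => (hf η hη).continuousAt.continuousWithinAt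
  have h1 := hμ.hasDerivAt_integral (t₀ := 0) one_pos
    (F := fun t η => f (planeRotation a b t η))
    (F' := fun t η => f' (planeRotation a b t η)
      ((-Real.sin t * inner ℝ a η - Real.cos t * inner ℝ b η) • a +
      (Real.cos t * inner ℝ a η - Real.sin t * inner ℝ b η) • b))
    (fun t _ => hfc.comp (planeRotation a b t).continuous.continuousOn (hmaps t))
    (fun t _ η hη => (hf _ (hmaps t hη)).comp_hasDerivAt t (hasDerivAt_planeRotation a b η t))
    (by
      refine ContinuousOn.clm_apply (hf'.comp hcont.continuousOn fun z hz => hmaps _ hz.2) ?_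
      fun_prop)
  have h2 : (fun t => ∫ η, f (planeRotation a b t η) ∂μ) = fun _ => ∫ η, f η ∂μ :=
    funext fun t => hμ.integral_comp_planeRotation ha hb hab f t
  rw [h2] at h1
  rw [← h1.unique (hasDerivAt_const _ _)]
  refine integral_congr_ae (Eventually.of_forall fun η => ?_)
  have : planeRotation a b 0 η = η := by simp [planeRotation_apply]
  simp only [this]
  congr 1
  simp [sub_eq_neg_add]

/-- The divergence theorem for the tangential part of a vector field on the sphere. -/
theorem IsUniformOnSphere.integral_tangential_div (hμ : IsUniformOnSphere μ) {ι : Type*} [Fintype ι]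
    (e : OrthonormalBasis ι ℝ E) {X : E → E} {X' : E → E →L[ℝ] E}
    (hX : ∀ η ∈ sphere (0 : E) 1, HasFDerivAt X (X' η) η)
    (hX' : ContinuousOn X' (sphere 0 1)) :
    ∫ η, ((∑ j, inner ℝ (e j) (X' η (e j))) - inner ℝ η (X' η η)
      - ((Fintype.card ι : ℝ) - 1) * inner ℝ η (X η)) ∂μ = 0 := by
  classical
  have hXc : ContinuousOn X (sphere 0 1) := fun η hη => (hX η hη).continuousAt.continuousWithinAt
  -- `G i j` is the derivative of `⟨e i, η⟩ ⟨e j, X η⟩` under rotation in the plane of `e i`, `e j`.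
  -- Summed over all pairs it gives the tangential divergence. The diagonal is set to zero because
  -- the rotation field vanishes there.
  let G : ι → ι → E → ℝ := fun i j η =>
    (inner ℝ (e i) η * inner ℝ (e j) (X' η (inner ℝ (e i) η • e j - inner ℝ (e j) η • e i)) +
      (if i = j then 0 else - inner ℝ (e j) η) * inner ℝ (e j) (X η))
  have hG : ∀ i j, ∫ η, G i j η ∂μ = 0 := by
    intro i j
    by_cases hij : i = j
    · subst hij; simp [G]
    have hinn : inner ℝ (e i) (e j) = (0 : ℝ) := e.orthonormal.2 hij
    have hinn' : inner ℝ (e j) (e i) = (0 : ℝ) := e.orthonormal.2 (Ne.symm hij)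
    have h1 := hμ.integral_angular_deriv (a := e i) (b := e j) (e.orthonormal.1 i)
      (e.orthonormal.1 j) hinn
      (f := fun η => inner ℝ (e i) η * inner ℝ (e j) (X η))
      (f' := fun η => inner ℝ (e i) η • ((innerSL ℝ (e j)).comp (X' η)) +
        (inner ℝ (e j) (X η) : ℝ) • innerSL ℝ (e i))
      (fun η hη => ((innerSL ℝ (e i)).hasFDerivAt).mul
        ((innerSL ℝ (e j)).hasFDerivAt.comp η (hX η hη)))
      (by fun_prop)
    rw [← h1]
    refine integral_congr_ae (Eventually.of_forall fun η => ?_)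
    simp [G, hij, inner_sub_right, inner_smul_right, hinn]
    ring
  have hGc : ∀ i j, ContinuousOn (G i j) (sphere 0 1) := by
    intro i j
    simp only [G]
    refine ((by fun_prop : ContinuousOn (fun η => inner ℝ (e i) η) _).mul
      (continuousOn_const.inner (hX'.clm_apply (by fun_prop)))).add (ContinuousOn.mul ?_
        (continuousOn_const.inner hXc))
    split_ifs <;> fun_prop
  have hsum : ∫ η, ∑ i, ∑ j, G i j η ∂μ = 0 := by
    rw [integral_finsetSum _ fun i _ =>
      integrable_finsetSum _ fun j _ => hμ.integrable (hGc i j)]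
    refine Finset.sum_eq_zero fun i _ => ?_
    rw [integral_finsetSum _ fun j _ => hμ.integrable (hGc i j)]
    exact Finset.sum_eq_zero fun j _ => hG i j
  rw [← hsum]
  refine hμ.integral_congr fun η hη => ?_
  have hη1 : ‖η‖ = 1 := by simpa using hη
  have hηη : inner ℝ η η = (1 : ℝ) := by rw [real_inner_self_eq_norm_sq, hη1]; norm_num
  have hrep : ∀ Z : E, ∑ j, inner ℝ (e j) η * inner ℝ (e j) Z = (inner ℝ η Z : ℝ) := by
    intro Z
    rw [← e.sum_inner_mul_inner η Z]
    simp [real_inner_comm]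
  have h1 : ∀ i j, G i j η = (inner ℝ (e i) η * inner ℝ (e i) η) * inner ℝ (e j) (X' η (e j))
      - inner ℝ (e j) η * (inner ℝ (e j) (X' η (inner ℝ (e i) η • e i)))
      + ((if i = j then inner ℝ (e j) η * inner ℝ (e j) (X η) else 0)
        - inner ℝ (e j) η * inner ℝ (e j) (X η)) := by
    intro i j
    simp only [G, map_sub, map_smul, inner_sub_right, inner_smul_right]
    split_ifs <;> ring
  simp only [h1, Finset.sum_add_distrib, Finset.sum_sub_distrib, hrep, ← Finset.mul_sum,
    ← Finset.sum_mul, Finset.sum_ite_eq, Finset.mem_univ, if_true, Finset.sum_const,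
    Finset.card_univ, nsmul_eq_mul]
  have h2 : ∑ i, inner ℝ η (X' η (inner ℝ (e i) η • e i)) = (inner ℝ η (X' η η) : ℝ) := by
    rw [← inner_sum, ← map_sum, e.sum_repr']
  rw [h2, hηη]
  ring

end Rotation

/-! ### Moments and one-coordinate marginals of the uniform measure. -/

section Moments

variable {E : Type*} [NormedAddCommGroup E] [InnerProductSpace ℝ E] [MeasurableSpace E]
  [BorelSpace E] [FiniteDimensional ℝ E] {μ : Measure E}

omit [MeasurableSpace E] [BorelSpace E] [FiniteDimensional ℝ E] in
theorem abs_inner_le_one {e η : E} (he : ‖e‖ = 1) (hη : η ∈ sphere (0 : E) 1) :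
    |inner ℝ e η| ≤ 1 := by
  have := abs_real_inner_le_norm e η
  have h1 : ‖η‖ = 1 := by simpa using hη
  rwa [he, h1, one_mul] at this

theorem IsUniformOnSphere.integral_inner (hμ : IsUniformOnSphere μ) (hd : 2 ≤ finrank ℝ E) (e : E) :
    ∫ η, inner ℝ e η ∂μ = 0 := by
  have h := hμ.integral_tangential_div (stdOrthonormalBasis ℝ E) (X := fun _ => e) (X' := fun _ => 0)
    (fun η _ => hasFDerivAt_const _ _) continuousOn_const
  have hd' : (2 : ℝ) ≤ finrank ℝ E := by exact_mod_cast hd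
  simp only [zero_apply, inner_zero_right, Finset.sum_const_zero, Fintype.card_fin,
    sub_zero, zero_sub, integral_neg, integral_const_mul, neg_eq_zero, mul_eq_zero] at h
  rcases h with h | h
  · linarith
  · simpa only [real_inner_comm] using h

/-- The divergence identity for the field `η ↦ ⟨a, η⟩ b`, whose trace is `⟨a, b⟩`. -/
theorem IsUniformOnSphere.integral_inner_mul_inner (hμ : IsUniformOnSphere μ) (a b : E) :
    finrank ℝ E * ∫ η, inner ℝ a η * inner ℝ b η ∂μ = inner ℝ a b := by
  have := hμ.isProbabilityMeasure
  have h := hμ.integral_tangential_div (stdOrthonormalBasis ℝ E)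
    (X := fun η => (inner ℝ a η : ℝ) • b) (X' := fun _ => (innerSL ℝ a).smulRight b)
    (fun η _ => ((innerSL ℝ a).smulRight b).hasFDerivAt) continuousOn_const
  have h2 : ∀ η : E, (∑ j, inner ℝ (stdOrthonormalBasis ℝ E j)
      (((innerSL ℝ a).smulRight b) (stdOrthonormalBasis ℝ E j)))
      - inner ℝ η (((innerSL ℝ a).smulRight b) η)
      - ((Fintype.card (Fin (finrank ℝ E)) : ℝ) - 1) * inner ℝ η ((inner ℝ a η : ℝ) • b)
      = inner ℝ a b - finrank ℝ E * (inner ℝ a η * inner ℝ b η) := by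
    intro η
    rw [← (stdOrthonormalBasis ℝ E).sum_inner_mul_inner a b]
    simp [inner_smul_right, real_inner_comm]
    ring
  simp only [h2] at h
  rw [integral_sub (integrable_const _) (hμ.integrable (by fun_prop))] at h
  simp only [integral_const, probReal_univ, one_smul, integral_const_mul] at h
  linarith

/-- The identity that characterizes the law of a coordinate on the sphere. -/
theorem IsUniformOnSphere.integral_comp_inner (hμ : IsUniformOnSphere μ) {e : E} (he : ‖e‖ = 1)
    {g g' : ℝ → ℝ} (hg : ∀ t, |t| ≤ 1 → HasDerivAt g (g' t) t) (hg' : ContinuousOn g' {t | |t| ≤ 1}) :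
    ∫ η, ((1 - inner ℝ e η ^ 2) * g' (inner ℝ e η) -
      (finrank ℝ E - 1) * (inner ℝ e η * g (inner ℝ e η))) ∂μ = 0 := by
  have hee : inner ℝ e e = (1 : ℝ) := by rw [real_inner_self_eq_norm_sq, he]; norm_num
  have h := hμ.integral_tangential_div (stdOrthonormalBasis ℝ E)
    (X := fun η => g (inner ℝ e η) • e)
    (X' := fun η => g' (inner ℝ e η) • (innerSL ℝ e).smulRight e)
    (fun η hη => ((hg _ (abs_inner_le_one he hη)).comp_hasFDerivAt η
      (innerSL ℝ e).hasFDerivAt).smul_const e |>.congr_fderiv (by ext; simp [mul_smul]))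
    (by
      have : ContinuousOn (fun η => g' (inner ℝ e η)) (sphere (0 : E) 1) :=
        hg'.comp (by fun_prop) fun η hη => abs_inner_le_one he hη
      exact this.smul continuousOn_const)
  rw [← h]
  refine integral_congr_ae (Eventually.of_forall fun η => ?_)
  have h3 := (stdOrthonormalBasis ℝ E).sum_inner_mul_inner e e
  rw [hee] at h3
  have h4 : ∑ j, inner ℝ (stdOrthonormalBasis ℝ E j)
      ((g' (inner ℝ e η) • (innerSL ℝ e).smulRight e) (stdOrthonormalBasis ℝ E j)) =
      g' (inner ℝ e η) := by
    conv_rhs => rw [← mul_one (g' (inner ℝ e η)), ← h3, Finset.mul_sum]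
    refine Finset.sum_congr rfl fun j _ => ?_
    simp [inner_smul_right]
  simp only [h4, Fintype.card_fin]
  simp [inner_smul_right, real_inner_comm]
  ring

end Moments

/-! ### The mean of `|⟨e, η⟩ - c|`. -/

section Cap

/-- A primitive `g` of `capDensity c` with `(1 - t ^ 2) g' - 2 t g = (1 + c ^ 2) / 2 - |t - c|`. -/
noncomputable def capSlope (c t : ℝ) : ℝ :=
  if t ≤ c then (1 - c) ^ 2 / (2 * (1 - t)) - 1 / 2 else 1 / 2 - (1 + c) ^ 2 / (2 * (1 + t))

/-- With `min` and `max` one of the two squared factors is always `1`, so a single formula serves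
both sides of `c` and shows continuity and positivity at once. -/
noncomputable def capDensity (c t : ℝ) : ℝ :=
  ((1 - c) / (1 - min t c)) ^ 2 * ((1 + c) / (1 + max t c)) ^ 2 / 2

variable {c : ℝ}

theorem continuous_capDensity (hc : |c| < 1) : Continuous (capDensity c) := by
  obtain ⟨h1, h2⟩ := abs_lt.1 hc
  unfold capDensity
  have e1 : ∀ t, 1 - min t c ≠ 0 := fun t => by linarith [min_le_right t c]
  have e2 : ∀ t, 1 + max t c ≠ 0 := fun t => by linarith [le_max_right t c]
  fun_prop (disch := assumption)

/-- The two branches of `capSlope` join at `c` with common value `-c / 2` and common slope `1 / 2`.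
-/
theorem hasDerivAt_capSlope (hc : |c| < 1) (t : ℝ) :
    HasDerivAt (capSlope c) (capDensity c t) t := by
  obtain ⟨h1, h2⟩ := abs_lt.1 hc
  have hl : ∀ t ≤ c, HasDerivWithinAt (capSlope c) (capDensity c t) (Set.Iic c) t := by
    intro t ht
    have h0 : 1 - t ≠ 0 := by linarith
    have hd : HasDerivAt (fun t => (1 - c) ^ 2 / (2 * (1 - t)) - 1 / 2) (capDensity c t) t := by
      refine (((hasDerivAt_const t ((1 - c) ^ 2)).div
        (((hasDerivAt_id t).const_sub 1).const_mul 2) (by simpa using h0)).sub_const _).congr_deriv ?_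
      have : 1 + c ≠ 0 := by linarith
      simp only [capDensity, min_eq_left ht, max_eq_right ht, id, div_self this]
      field_simp
      ring
    exact hd.hasDerivWithinAt.congr (fun x hx => if_pos hx) (if_pos ht)
  have hr : ∀ t, c ≤ t → HasDerivWithinAt (capSlope c) (capDensity c t) (Set.Ici c) t := by
    intro t ht
    have h0 : 1 + t ≠ 0 := by linarith
    have hd : HasDerivAt (fun t => 1 / 2 - (1 + c) ^ 2 / (2 * (1 + t))) (capDensity c t) t := by
      refine (((hasDerivAt_const t ((1 + c) ^ 2)).div
        (((hasDerivAt_id t).const_add 1).const_mul 2) (by simpa using h0)).const_sub _).congr_deriv ?_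
      have : 1 - c ≠ 0 := by linarith
      simp only [capDensity, min_eq_right ht, max_eq_left ht, id, div_self this]
      field_simp
      ring
    have he : ∀ x, c ≤ x → capSlope c x = 1 / 2 - (1 + c) ^ 2 / (2 * (1 + x)) := by
      intro x hx
      rcases hx.eq_or_lt with rfl | hx
      · have : 1 - c ≠ 0 := by linarith
        have : 1 + c ≠ 0 := by linarith
        rw [capSlope, if_pos le_rfl]
        field_simp
        ring
      · exact if_neg hx.not_ge
    exact hd.hasDerivWithinAt.congr he (he t ht)
  rcases lt_trichotomy t c with ht | rfl | ht
  · exact (hl t ht.le).hasDerivAt (Iic_mem_nhds ht)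
  · have := (hl t le_rfl).union (hr t le_rfl)
    rwa [Set.Iic_union_Ici, hasDerivWithinAt_univ] at this
  · exact (hr t ht.le).hasDerivAt (Ici_mem_nhds ht)

/-- The left side is `((1 - t²) g)'`, the integrand of `IsUniformOnSphere.integral_comp_inner` in
dimension 3. The constant `(1 + c²) / 2` is the mean of `|t - c|` over `[-1, 1]`, which is what
allows `g` to stay bounded at both endpoints. -/
theorem capSlope_identity (hc : |c| < 1) {t : ℝ} :
    (1 - t ^ 2) * capDensity c t - 2 * (t * capSlope c t) = (1 + c ^ 2) / 2 - |t - c| := by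
  obtain ⟨h1, h2⟩ := abs_lt.1 hc
  have h3 : 1 - c ≠ 0 := by linarith
  have h4 : 1 + c ≠ 0 := by linarith
  by_cases ht : t ≤ c
  · have h0 : 1 - t ≠ 0 := by linarith
    rw [abs_of_nonpos (by linarith), capSlope, if_pos ht, capDensity, min_eq_left ht,
      max_eq_right ht, div_self h4]
    field_simp
    ring
  · have h0 : 1 + t ≠ 0 := by linarith
    rw [abs_of_nonneg (by linarith), capSlope, if_neg ht, capDensity, min_eq_right (by linarith),
      max_eq_left (by linarith), div_self h3]
    field_simp
    ring

theorem le_capDensity (hc : |c| < 1) {t : ℝ} (ht : |t| ≤ 1) :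
    ((1 - c) / 2) ^ 2 * ((1 + c) / 2) ^ 2 / 2 ≤ capDensity c t := by
  obtain ⟨h1, h2⟩ := abs_lt.1 hc
  obtain ⟨h3, h4⟩ := abs_le.1 ht
  have e1 : 0 < 1 - min t c := by linarith [min_le_right t c]
  have e2 : 0 < 1 + max t c := by linarith [le_max_right t c]
  have e3 : 1 - min t c ≤ 2 := by linarith [le_min h3 h1.le]
  have e4 : 1 + max t c ≤ 2 := by linarith [max_le h4 h2.le]
  have e5 : 0 < 1 - c := by linarith
  have e6 : 0 < 1 + c := by linarith
  unfold capDensity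
  gcongr

theorem le_mul_capSlope_sub (hc : |c| < 1) {t : ℝ} (ht : |t| ≤ 1) :
    ((1 - c) / 2) ^ 2 * ((1 + c) / 2) ^ 2 / 2 * t ^ 2 ≤ t * (capSlope c t - capSlope c 0) := by
  obtain ⟨h3, h4⟩ := abs_le.1 ht
  set δ := ((1 - c) / 2) ^ 2 * ((1 + c) / 2) ^ 2 / 2
  have hmono : ∀ x ∈ Set.Icc (-1 : ℝ) 1, ∀ y ∈ Set.Icc (-1 : ℝ) 1, x ≤ y →
      δ * (y - x) ≤ capSlope c y - capSlope c x := by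
    refine (convex_Icc (-1 : ℝ) 1).mul_sub_le_image_sub_of_le_deriv
      (fun x _ => (hasDerivAt_capSlope hc x).continuousAt.continuousWithinAt)
      (fun x _ => (hasDerivAt_capSlope hc x).differentiableAt.differentiableWithinAt) ?_
    intro x hx
    rw [(hasDerivAt_capSlope hc x).deriv]
    exact le_capDensity hc (abs_le.2 (Set.mem_Icc.1 (interior_subset hx)))
  rcases le_total 0 t with h | h
  · have := hmono 0 (by simp) t ⟨h3, h4⟩ h
    nlinarith
  · have := hmono t ⟨h3, h4⟩ 0 (by simp) h
    nlinarith

variable {E : Type*} [NormedAddCommGroup E] [InnerProductSpace ℝ E] [MeasurableSpace E]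
  [BorelSpace E] [FiniteDimensional ℝ E] {μ : Measure E}

/-- Passing from dimension 3 to dimension `d` in the identity for `g = capSlope c` leaves the defect
`(d - 3) ∫ t g(t)`, with `t = ⟨e, η⟩`. It is positive for `d > 3` because `g` is strictly increasing
and `t` has mean zero. -/
theorem IsUniformOnSphere.exists_integral_abs_inner_sub_le (hμ : IsUniformOnSphere μ)
    (hd : 3 ≤ finrank ℝ E) {e : E} (he : ‖e‖ = 1) (hc : |c| < 1) :
    ∃ δ > 0, ∫ η, |inner ℝ e η - c| ∂μ + (finrank ℝ E - 3) * δ ≤ (1 + c ^ 2) / 2 := by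
  have := hμ.isProbabilityMeasure
  obtain ⟨h1, h2⟩ := abs_lt.1 hc
  have hd' : (3 : ℝ) ≤ finrank ℝ E := by exact_mod_cast hd
  have hcont : Continuous (capSlope c) :=
    continuous_iff_continuousAt.2 fun t => (hasDerivAt_capSlope hc t).continuousAt
  have e5 : 0 < 1 - c := by linarith
  have e6 : 0 < 1 + c := by linarith
  set δ := ((1 - c) / 2) ^ 2 * ((1 + c) / 2) ^ 2 / 2
  have hδ : 0 < δ := by positivity
  have hT := hμ.integral_inner_mul_inner e e
  rw [real_inner_self_eq_norm_sq, he, one_pow] at hT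
  refine ⟨δ / finrank ℝ E, by positivity, ?_⟩
  have hI := hμ.integral_comp_inner he (fun t _ => hasDerivAt_capSlope hc t)
    (continuous_capDensity hc).continuousOn
  have hrw : ∀ η : E, (1 - inner ℝ e η ^ 2) * capDensity c (inner ℝ e η) -
      (finrank ℝ E - 1) * (inner ℝ e η * capSlope c (inner ℝ e η)) =
      (1 + c ^ 2) / 2 - |inner ℝ e η - c|
        - (finrank ℝ E - 3) * (inner ℝ e η * capSlope c (inner ℝ e η)) := by
    intro η
    rw [← capSlope_identity hc]
    ring
  simp only [hrw] at hI
  rw [integral_sub (hμ.integrable (by fun_prop)) (hμ.integrable (by fun_prop)),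
    integral_sub (integrable_const _) (hμ.integrable (by fun_prop)), integral_const_mul] at hI
  simp only [integral_const, probReal_univ, one_smul] at hI
  have hlow : δ / finrank ℝ E ≤ ∫ η, inner ℝ e η * capSlope c (inner ℝ e η) ∂μ := by
    -- The term with `capSlope c 0` has integral zero; it recenters `g` so that the pointwise bound
    -- `δ t² ≤ t (g t - g 0)` applies.
    have h3 : δ / finrank ℝ E = ∫ η, δ * (inner ℝ e η * inner ℝ e η) +
        capSlope c 0 * inner ℝ e η ∂μ := by
      rw [integral_add (hμ.integrable (by fun_prop)) (hμ.integrable (by fun_prop)),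
        integral_const_mul, integral_const_mul, hμ.integral_inner (by omega)]
      rw [div_eq_iff (by positivity)]
      linear_combination (-δ) * hT
    rw [h3]
    refine hμ.integral_mono (by fun_prop) (by fun_prop) fun η hη => ?_
    have h4 : δ * inner ℝ e η ^ 2 ≤ _ := le_mul_capSlope_sub hc (abs_inner_le_one he hη)
    linear_combination h4
  nlinarith [mul_le_mul_of_nonneg_left hlow (sub_nonneg.2 hd')]

end Cap

/-! ### Angular averages on spheres of radius `r`. -/

section Radial

variable {E : Type*} [NormedAddCommGroup E] [InnerProductSpace ℝ E]

theorem smul_mem_ball_of_mem_sphere {r : ℝ} (hr : |r| < 1) {η : E} (hη : η ∈ sphere (0 : E) 1) :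
    r • η ∈ ball (0 : E) 1 := by
  have : ‖η‖ = 1 := by simpa using hη
  simpa [norm_smul, this] using hr

variable [FiniteDimensional ℝ E]

variable (E) in
/-- The vector representing a continuous linear form, depending linearly on the form. -/
noncomputable def sharp : (E →L[ℝ] ℝ) →L[ℝ] E :=
  ∑ j, (ContinuousLinearMap.apply ℝ ℝ (stdOrthonormalBasis ℝ E j)).smulRight
    (stdOrthonormalBasis ℝ E j)

theorem inner_sharp (x : E) (l : E →L[ℝ] ℝ) : inner ℝ x (sharp E l) = l x := by
  conv_rhs => rw [← (stdOrthonormalBasis ℝ E).sum_repr' x]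
  simp [sharp, inner_sum, inner_smul_right, real_inner_comm, mul_comm]

theorem laplacian_eq_sum_fderiv_fderiv {F : Type*} [NormedAddCommGroup F] [NormedSpace ℝ F]
    {ι : Type*} [Fintype ι] (b : OrthonormalBasis ι ℝ E) (v : E → F) (x : E) :
    Laplacian.laplacian v x = ∑ j, fderiv ℝ (fderiv ℝ v) x (b j) (b j) := by
  rw [laplacian_eq_iteratedFDeriv_orthonormalBasis v b]
  simp [iteratedFDeriv_two_apply]

variable [MeasurableSpace E] [BorelSpace E] {μ : Measure E}

theorem IsUniformOnSphere.hasDerivAt_radial (hμ : IsUniformOnSphere μ) {f Y : E → ℝ}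
    (hf : ContDiffOn ℝ 1 f (ball 0 1)) (hY : Continuous Y) {r : ℝ} (hr : |r| < 1) :
    HasDerivAt (fun r : ℝ => ∫ η, Y η * f (r • η) ∂μ)
      (∫ η, Y η * fderiv ℝ f (r • η) η ∂μ) r := by
  obtain ⟨ε, hε, hε'⟩ : ∃ ε > 0, |r| + ε < 1 := ⟨(1 - |r|) / 2, by linarith, by linarith⟩
  have hmem : ∀ t ∈ closedBall r ε, ∀ η ∈ sphere (0 : E) 1, t • η ∈ ball (0 : E) 1 := by
    intro t ht η hη
    refine smul_mem_ball_of_mem_sphere ?_ hη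
    have h1 : |t - r| ≤ ε := by simpa [Real.dist_eq] using ht
    linarith [abs_sub_abs_le_abs_sub t r]
  have hf' : ContinuousOn (fderiv ℝ f) (ball 0 1) :=
    hf.continuousOn_fderiv_of_isOpen isOpen_ball le_rfl
  refine hμ.hasDerivAt_integral hε (F := fun t η => Y η * f (t • η))
    (F' := fun t η => Y η * fderiv ℝ f (t • η) η) ?_ ?_ ?_
  · intro t ht
    exact hY.continuousOn.mul (hf.continuousOn.comp (by fun_prop) (hmem t ht))
  · intro t ht η hη
    have h1 : HasDerivAt (fun t : ℝ => t • η) η t := by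
      simpa using (hasDerivAt_id t).smul_const η
    have h2 := ((hf.differentiableOn one_ne_zero _ (hmem t ht η hη)).differentiableAt
      (isOpen_ball.mem_nhds (hmem t ht η hη))).hasFDerivAt
    exact (h2.comp_hasDerivAt t h1).const_mul _
  · refine (by fun_prop : Continuous fun z : ℝ × E => Y z.2).continuousOn.mul
      (ContinuousOn.clm_apply (hf'.comp (f := fun z : ℝ × E => z.1 • z.2) (by fun_prop) ?_)
        (by fun_prop))
    exact fun z hz => hmem _ hz.1 _ hz.2

variable {v : E → ℝ}

omit [FiniteDimensional ℝ E] [MeasurableSpace E] [BorelSpace E] in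
theorem ContDiffOn.hasFDerivAt_fderiv (hv : ContDiffOn ℝ 2 v (ball 0 1)) {x : E}
    (hx : x ∈ ball (0 : E) 1) :
    HasFDerivAt (fderiv ℝ v) (fderiv ℝ (fderiv ℝ v) x) x :=
  (((hv.fderiv_of_isOpen isOpen_ball (m := 1) (by norm_num)).differentiableOn one_ne_zero
    x hx).differentiableAt (isOpen_ball.mem_nhds hx)).hasFDerivAt

omit [FiniteDimensional ℝ E] [MeasurableSpace E] [BorelSpace E] in
theorem ContDiffOn.continuousOn_fderiv_fderiv (hv : ContDiffOn ℝ 2 v (ball 0 1)) :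
    ContinuousOn (fderiv ℝ (fderiv ℝ v)) (ball 0 1) :=
  (hv.fderiv_of_isOpen isOpen_ball (m := 1) (by norm_num)).continuousOn_fderiv_of_isOpen
    isOpen_ball le_rfl

/-- Integration by parts against `Y = s + ⟨e, ·⟩` on the sphere of radius `r`. -/
theorem IsUniformOnSphere.integral_laplacian (hμ : IsUniformOnSphere μ)
    (hv : ContDiffOn ℝ 2 v (ball 0 1)) {r : ℝ} (hr : |r| < 1) (s : ℝ) (e : E) :
    ∫ η, (fderiv ℝ v (r • η) e + r * (s + inner ℝ e η) * Laplacian.laplacian v (r • η)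
      - inner ℝ e η * fderiv ℝ v (r • η) η
      - r * (s + inner ℝ e η) * fderiv ℝ (fderiv ℝ v) (r • η) η η
      - (finrank ℝ E - 1) * ((s + inner ℝ e η) * fderiv ℝ v (r • η) η)) ∂μ = 0 := by
  have hmem : Set.MapsTo (fun η : E => r • η) (sphere 0 1) (ball 0 1) :=
    fun η hη => smul_mem_ball_of_mem_sphere hr hη
  have hc1 : ContinuousOn (fun η => fderiv ℝ v (r • η)) (sphere 0 1) :=
    (hv.continuousOn_fderiv_of_isOpen isOpen_ball (by norm_num)).comp (by fun_prop) hmem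
  have hc2 : ContinuousOn (fun η => fderiv ℝ (fderiv ℝ v) (r • η)) (sphere 0 1) :=
    hv.continuousOn_fderiv_fderiv.comp (by fun_prop) hmem
  let S : E → E →L[ℝ] E := fun η => (sharp E).comp (r • fderiv ℝ (fderiv ℝ v) (r • η))
  let R : (E →L[ℝ] ℝ) → E →L[ℝ] E := fun l => (innerSL ℝ e).smulRight (sharp E l)
  have h := hμ.integral_tangential_div (stdOrthonormalBasis ℝ E)
    (X := fun η => (s + inner ℝ e η) • sharp E (fderiv ℝ v (r • η)))
    (X' := fun η => (s + inner ℝ e η) • S η +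
      ContinuousLinearMap.smulRightL ℝ E E (innerSL ℝ e) (sharp E (fderiv ℝ v (r • η))))
    (fun η hη => by
      have h1 : HasFDerivAt (fun η => fderiv ℝ v (r • η)) (r • fderiv ℝ (fderiv ℝ v) (r • η)) η := by
        refine ((hv.hasFDerivAt_fderiv (hmem hη)).comp η
          ((ContinuousLinearMap.id ℝ E).hasFDerivAt.const_smul r)).congr_fderiv ?_
        ext; simp
      exact (((innerSL ℝ e).hasFDerivAt (x := η)).const_add s).smul
        ((sharp E).hasFDerivAt.comp η h1))
    (by
      have hc3 : ContinuousOn S (sphere 0 1) := by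
        exact continuousOn_const.clm_comp (hc2.const_smul r)
      have hc4 : ContinuousOn (fun η => sharp E (fderiv ℝ v (r • η))) (sphere 0 1) :=
        (sharp E).continuous.comp_continuousOn hc1
      exact ((by fun_prop : ContinuousOn (fun η => s + inner ℝ e η) _).smul hc3).add
        ((ContinuousLinearMap.continuous _).comp_continuousOn hc4))
  rw [← h]
  refine integral_congr_ae (Eventually.of_forall fun η => ?_)
  have h5 : ∑ j, inner ℝ (stdOrthonormalBasis ℝ E j) e
      * fderiv ℝ v (r • η) (stdOrthonormalBasis ℝ E j) = fderiv ℝ v (r • η) e := by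
    conv_rhs => rw [← (stdOrthonormalBasis ℝ E).sum_repr' e]
    simp
  simp only [laplacian_eq_sum_fderiv_fderiv (stdOrthonormalBasis ℝ E), ← h5, S, Fintype.card_fin]
  simp [inner_add_right, inner_smul_right, inner_sharp, Finset.sum_add_distrib, Finset.mul_sum,
    real_inner_comm, mul_assoc, mul_left_comm]
  ring

/-- The divergence identity for `η ↦ v(rη) e`. It trades the mean of `D_e v`, which is not an
angular moment of `v`, for such moments. -/
theorem IsUniformOnSphere.integral_fderiv_apply (hμ : IsUniformOnSphere μ)
    (hv : ContDiffOn ℝ 2 v (ball 0 1)) {r : ℝ} (hr : |r| < 1) (e : E) :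
    ∫ η, (r * fderiv ℝ v (r • η) e - r * (inner ℝ e η * fderiv ℝ v (r • η) η)
      - (finrank ℝ E - 1) * (inner ℝ e η * v (r • η))) ∂μ = 0 := by
  have hmem : Set.MapsTo (fun η : E => r • η) (sphere 0 1) (ball 0 1) :=
    fun η hη => smul_mem_ball_of_mem_sphere hr hη
  have hc1 : ContinuousOn (fun η => fderiv ℝ v (r • η)) (sphere 0 1) :=
    (hv.continuousOn_fderiv_of_isOpen isOpen_ball (by norm_num)).comp (by fun_prop) hmem
  have h := hμ.integral_tangential_div (stdOrthonormalBasis ℝ E)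
    (X := fun η => v (r • η) • e)
    (X' := fun η => ContinuousLinearMap.smulRightL ℝ E E (r • fderiv ℝ v (r • η)) e)
    (fun η hη => by
      have h1 : HasFDerivAt (fun η => v (r • η)) (r • fderiv ℝ v (r • η)) η := by
        have h2 := ((hv.differentiableOn two_ne_zero _ (hmem hη)).differentiableAt
          (isOpen_ball.mem_nhds (hmem hη))).hasFDerivAt
        refine (h2.comp η ((ContinuousLinearMap.id ℝ E).hasFDerivAt.const_smul r)).congr_fderiv ?_
        ext; simp
      exact h1.smul_const e)
    (by
      exact ContinuousOn.clm_apply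
        ((ContinuousLinearMap.continuous _).comp_continuousOn (hc1.const_smul r)) continuousOn_const)
  rw [← h]
  refine integral_congr_ae (Eventually.of_forall fun η => ?_)
  have h5 : ∑ j, inner ℝ (stdOrthonormalBasis ℝ E j) e
      * fderiv ℝ v (r • η) (stdOrthonormalBasis ℝ E j) = fderiv ℝ v (r • η) e := by
    conv_rhs => rw [← (stdOrthonormalBasis ℝ E).sum_repr' e]
    simp
  simp only [← h5, Fintype.card_fin]
  simp [inner_smul_right, Finset.mul_sum, real_inner_comm, mul_comm]

end Radial

theorem MeasureTheory.Integrable.sub_fun {α : Type*} [MeasurableSpace α] {μ : Measure α}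
    {f g : α → ℝ} (hf : Integrable f μ) (hg : Integrable g μ) :
    Integrable (fun x => f x - g x) μ :=
  hf.sub hg

/-! ### The ODE of the angular moments and its consequences. -/

section RadialODE

variable {E : Type*} [NormedAddCommGroup E] [InnerProductSpace ℝ E] {v : E → ℝ}

theorem ContDiffOn.fderiv_apply_self (hv : ContDiffOn ℝ 2 v (ball 0 1)) :
    ContDiffOn ℝ 1 (fun x => fderiv ℝ v x x) (ball 0 1) :=
  (hv.fderiv_of_isOpen isOpen_ball (m := 1) (by norm_num)).clm_apply contDiffOn_id

theorem ContDiffOn.fderiv_fderiv_apply_self (hv : ContDiffOn ℝ 2 v (ball 0 1)) {x : E}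
    (hx : x ∈ ball (0 : E) 1) (y : E) :
    fderiv ℝ (fun x => fderiv ℝ v x x) x y = fderiv ℝ (fderiv ℝ v) x y x + fderiv ℝ v x y := by
  have h : HasFDerivAt (fun x => fderiv ℝ v x x) _ x :=
    (hv.hasFDerivAt_fderiv hx).clm_apply (hasFDerivAt_id x)
  rw [h.fderiv]
  simp [add_comm]

variable [FiniteDimensional ℝ E] [MeasurableSpace E] [BorelSpace E] {μ : Measure E}

/-- The ordinary differential equation of the angular moments of a solution of
`Δ v + b(|x|) x · ∇v = 0`. -/
theorem IsUniformOnSphere.radial_ode (hμ : IsUniformOnSphere μ)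
    (hv : ContDiffOn ℝ 2 v (ball 0 1)) {b : ℝ → ℝ}
    (heq : ∀ x ∈ ball (0 : E) 1, Laplacian.laplacian v x + b ‖x‖ * fderiv ℝ v x x = 0)
    (s : ℝ) (e : E) {r : ℝ} (hr : r ∈ Set.Ioo (0 : ℝ) 1) :
    HasDerivAt (fun r : ℝ => ∫ η, (s + inner ℝ e η) * fderiv ℝ v (r • η) (r • η) ∂μ)
      (-((finrank ℝ E - 2) / r + b r * r) *
          ∫ η, (s + inner ℝ e η) * fderiv ℝ v (r • η) (r • η) ∂μ +
        (finrank ℝ E - 1) / r * ∫ η, inner ℝ e η * v (r • η) ∂μ) r := by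
  obtain ⟨hr0, hr1⟩ := hr
  have hr' : |r| < 1 := by rwa [abs_of_pos hr0]
  have hmem : Set.MapsTo (fun η : E => r • η) (sphere 0 1) (ball 0 1) :=
    fun η hη => smul_mem_ball_of_mem_sphere hr' hη
  have hc0 : ContinuousOn (fun η => v (r • η)) (sphere 0 1) :=
    hv.continuousOn.comp (by fun_prop) hmem
  have hc1 : ContinuousOn (fun η => fderiv ℝ v (r • η)) (sphere 0 1) :=
    (hv.continuousOn_fderiv_of_isOpen isOpen_ball (by norm_num)).comp (by fun_prop) hmem
  have hc2 : ContinuousOn (fun η => fderiv ℝ (fderiv ℝ v) (r • η)) (sphere 0 1) :=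
    hv.continuousOn_fderiv_fderiv.comp (by fun_prop) hmem
  have hc3 : ContinuousOn (fun η => fderiv ℝ v (r • η) η) (sphere 0 1) :=
    hc1.clm_apply continuousOn_id
  have hc4 : ContinuousOn (fun η => fderiv ℝ (fderiv ℝ v) (r • η) η η) (sphere 0 1) :=
    (hc2.clm_apply continuousOn_id).clm_apply continuousOn_id
  have hc5 : ContinuousOn (fun η => fderiv ℝ v (r • η) e) (sphere 0 1) :=
    hc1.clm_apply continuousOn_const
  refine (hμ.hasDerivAt_radial hv.fderiv_apply_self
    (Y := fun η => s + inner ℝ e η) (by fun_prop) hr').congr_deriv ?_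
  set A := ∫ η, (s + inner ℝ e η) * fderiv ℝ v (r • η) η ∂μ with hA
  set B := ∫ η, inner ℝ e η * fderiv ℝ v (r • η) η ∂μ with hB
  set H := ∫ η, (s + inner ℝ e η) * fderiv ℝ (fderiv ℝ v) (r • η) η η ∂μ with hH
  set P := ∫ η, fderiv ℝ v (r • η) e ∂μ with hP
  set M := ∫ η, inner ℝ e η * v (r • η) ∂μ with hM
  have i1 := hμ.integrable hc5
  have i2 : Integrable (fun η => (s + inner ℝ e η) * fderiv ℝ v (r • η) η) μ :=
    hμ.integrable (by fun_prop)
  have i3 : Integrable (fun η => inner ℝ e η * fderiv ℝ v (r • η) η) μ :=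
    hμ.integrable (by fun_prop)
  have i4 : Integrable (fun η => (s + inner ℝ e η) * fderiv ℝ (fderiv ℝ v) (r • η) η η) μ :=
    hμ.integrable (by fun_prop)
  have i5 : Integrable (fun η => inner ℝ e η * v (r • η)) μ :=
    hμ.integrable ((by fun_prop : ContinuousOn (fun η : E => inner ℝ e η) _).mul hc0)
  have e1 : ∫ η, (s + inner ℝ e η) * fderiv ℝ v (r • η) (r • η) ∂μ = r * A := by
    rw [hA, ← integral_const_mul]
    congr 1; ext η; simp; ring
  have e2 : ∫ η, (s + inner ℝ e η) * fderiv ℝ (fun x => fderiv ℝ v x x) (r • η) η ∂μ =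
      r * H + A := by
    rw [hA, hH, ← integral_const_mul, ← integral_add (i4.const_mul _) i2]
    refine hμ.integral_congr fun η hη => ?_
    rw [hv.fderiv_fderiv_apply_self (hmem hη)]
    simp; ring
  -- `e3` and `e4` are the two integrations by parts; eliminating `P`, the mean of `D_e v`, between
  -- them closes the equation.
  have e3 : r * P - r * B - (finrank ℝ E - 1) * M = 0 := by
    rw [← hμ.integral_fderiv_apply hv hr' e, integral_sub ((i1.const_mul _).sub_fun (i3.const_mul _))
      (i5.const_mul _), integral_sub (i1.const_mul _) (i3.const_mul _)]
    simp only [integral_const_mul, hP, hB, hM]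
  have e4 : P - b r * r * (r * A) - B - r * H - (finrank ℝ E - 1) * A = 0 := by
    have h := hμ.integral_laplacian hv hr' s e
    have hL : ∫ η, (fderiv ℝ v (r • η) e - b r * r * r * ((s + inner ℝ e η) * fderiv ℝ v (r • η) η)
      - inner ℝ e η * fderiv ℝ v (r • η) η
      - r * ((s + inner ℝ e η) * fderiv ℝ (fderiv ℝ v) (r • η) η η)
      - (finrank ℝ E - 1) * ((s + inner ℝ e η) * fderiv ℝ v (r • η) η)) ∂μ = 0 := by
      rw [← h]
      refine hμ.integral_congr fun η hη => ?_
      have h1 := heq _ (hmem hη)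
      have h2 : ‖r • η‖ = r := by
        have : ‖η‖ = 1 := by simpa using hη
        rw [norm_smul, this, Real.norm_eq_abs, abs_of_pos hr0, mul_one]
      rw [h2, map_smul, smul_eq_mul] at h1
      linear_combination (-r * (s + inner ℝ e η)) * h1
    have j1 := i1.sub_fun (i2.const_mul (b r * r * r))
    have j2 := j1.sub_fun i3
    have j3 := j2.sub_fun (i4.const_mul r)
    rw [integral_sub j3 (i2.const_mul _), integral_sub j2 (i4.const_mul _), integral_sub j1 i3,
      integral_sub i1 (i2.const_mul _)] at hL
    simp only [integral_const_mul] at hL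
    rw [← hA, ← hB, ← hH, ← hP] at hL
    linarith
  rw [e1, e2]
  field_simp
  linear_combination e3 - r * e4

/-- The spherical mean value property. -/
theorem IsUniformOnSphere.integral_eq_center (hμ : IsUniformOnSphere μ) (hd : 2 ≤ finrank ℝ E)
    (hv : ContDiffOn ℝ 2 v (ball 0 1)) {b : ℝ → ℝ} (hb : ∀ r ∈ Set.Ioo (0 : ℝ) 1, 0 ≤ b r)
    (heq : ∀ x ∈ ball (0 : E) 1, Laplacian.laplacian v x + b ‖x‖ * fderiv ℝ v x x = 0)
    {r : ℝ} (hr : r ∈ Set.Ico (0 : ℝ) 1) :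
    ∫ η, v (r • η) ∂μ = v 0 := by
  have := hμ.isProbabilityMeasure
  have hd' : (2 : ℝ) ≤ finrank ℝ E := by exact_mod_cast hd
  have habs : ∀ t ∈ Set.Icc 0 r, |t| < 1 := fun t ht => by
    rw [abs_of_nonneg ht.1]; linarith [ht.2, hr.2]
  -- The weight `1 + ⟨0, η⟩` is the case `s = 1`, `e = 0` of `IsUniformOnSphere.radial_ode`.
  set N : ℝ → ℝ := fun r => ∫ η, (1 + inner ℝ (0 : E) η) * fderiv ℝ v (r • η) (r • η) ∂μ with hN
  have hNd : ∀ t ∈ Set.Icc 0 r, DifferentiableAt ℝ N t := fun t ht =>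
    (hμ.hasDerivAt_radial hv.fderiv_apply_self (Y := fun η => 1 + inner ℝ (0 : E) η) (by fun_prop)
      (habs t ht)).differentiableAt
  have hNc : ContinuousOn N (Set.Icc 0 r) := fun t ht => (hNd t ht).continuousAt.continuousWithinAt
  -- Since `N' = -(nonnegative) N`, the square decreases from `N 0 = 0`. This gives `N = 0` without
  -- solving an equation that is singular at `0`.
  have hanti : AntitoneOn (fun t => N t ^ 2) (Set.Icc 0 r) := by
    refine antitoneOn_of_deriv_nonpos (convex_Icc 0 r) (hNc.pow 2)
      (fun t ht => ((hNd t (interior_subset ht)).pow 2).differentiableWithinAt) fun t ht => ?_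
    rw [interior_Icc] at ht
    have ht' : t ∈ Set.Ioo (0 : ℝ) 1 := ⟨ht.1, ht.2.trans hr.2⟩
    have h1 := (hμ.radial_ode hv heq 1 0 ht').fun_pow 2
    simp only [inner_zero_left, zero_mul, integral_zero, mul_zero, add_zero] at h1
    simp only [hN, inner_zero_left, add_zero]
    rw [h1.deriv]
    have h3 : 0 ≤ (finrank ℝ E - 2) / t + b t * t :=
      add_nonneg (div_nonneg (by linarith) ht.1.le) (mul_nonneg (hb t ht') ht.1.le)
    have h4 : 0 ≤ (∫ η, 1 * fderiv ℝ v (t • η) (t • η) ∂μ) ^ 2 := sq_nonneg _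
    norm_num
    norm_num at h4
    nlinarith [mul_nonneg h3 h4]
  have hN0 : N 0 = 0 := by simp [hN]
  have hNz : ∀ t ∈ Set.Icc 0 r, N t = 0 := by
    intro t ht
    have h1 := hanti ⟨le_rfl, hr.1⟩ ht ht.1
    simp only [hN0] at h1
    nlinarith
  have hM : ∀ t ∈ Set.Icc 0 r, HasDerivAt (fun t : ℝ => ∫ η, 1 * v (t • η) ∂μ) 0 t := by
    intro t ht
    refine (hμ.hasDerivAt_radial (hv.of_le (by norm_num)) (Y := fun _ => 1) continuous_const
      (habs t ht)).congr_deriv ?_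
    rcases ht.1.eq_or_lt with rfl | h0
    · have := hμ.integral_inner hd (sharp E (fderiv ℝ v 0))
      simp only [real_inner_comm, inner_sharp] at this
      simpa using this
    · have h1 := hNz t ht
      simp only [hN, inner_zero_left, add_zero, map_smul, smul_eq_mul, mul_left_comm] at h1
      rw [integral_const_mul] at h1
      exact (mul_eq_zero.1 h1).resolve_left h0.ne'
  have hconst := constant_of_has_deriv_right_zero
    (fun t ht => (hM t ht).continuousAt.continuousWithinAt)
    (fun t ht => (hM t (Set.Ico_subset_Icc_self ht)).hasDerivWithinAt) r ⟨hr.1, le_rfl⟩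
  simpa using hconst

/-- The derivative at the center, expressed by the first angular moment on a sphere. -/
theorem IsUniformOnSphere.fderiv_center_eq (hμ : IsUniformOnSphere μ) (hd : 2 ≤ finrank ℝ E)
    (hv : ContDiffOn ℝ 2 v (ball 0 1)) {b p q : ℝ → ℝ}
    (heq : ∀ x ∈ ball (0 : E) 1, Laplacian.laplacian v x + b ‖x‖ * fderiv ℝ v x x = 0)
    (hp : ∀ r ∈ Set.Ioo (0 : ℝ) 1,
      HasDerivAt p (p r * ((finrank ℝ E - 1) / r + b r * r) - q r) r)
    (hq : ∀ r ∈ Set.Ioo (0 : ℝ) 1, HasDerivAt q (-(p r * (finrank ℝ E - 1) / r ^ 2)) r)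
    (hp0 : Tendsto p (𝓝[>] 0) (𝓝 1))
    (hq0 : Tendsto (fun r => r * q r) (𝓝[>] 0) (𝓝 (finrank ℝ E - 1)))
    (e : E) {r : ℝ} (hr : r ∈ Set.Ioo (0 : ℝ) 1) :
    p r * (∫ η, inner ℝ e η * fderiv ℝ v (r • η) η ∂μ) +
      q r * (∫ η, inner ℝ e η * v (r • η) ∂μ) = fderiv ℝ v 0 e := by
  have habs : ∀ t ∈ Set.Ico (0 : ℝ) 1, |t| < 1 := fun t ht => by
    rw [abs_of_nonneg ht.1]; exact ht.2
  have hd' : (2 : ℝ) ≤ finrank ℝ E := by exact_mod_cast hd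
  set N : ℝ → ℝ := fun r => ∫ η, inner ℝ e η * fderiv ℝ v (r • η) (r • η) ∂μ with hN
  set M : ℝ → ℝ := fun r => ∫ η, inner ℝ e η * v (r • η) ∂μ with hM
  set A : ℝ → ℝ := fun r => ∫ η, inner ℝ e η * fderiv ℝ v (r • η) η ∂μ with hA
  have hNA : ∀ t, N t = t * A t := by
    intro t
    simp only [hN, hA]
    rw [← integral_const_mul]
    congr 1; ext η; simp; ring
  have hMd : ∀ t ∈ Set.Ico (0 : ℝ) 1, HasDerivAt M (A t) t := fun t ht =>
    hμ.hasDerivAt_radial (hv.of_le (by norm_num)) (by fun_prop) (habs t ht)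
  have hNd : ∀ t ∈ Set.Ioo (0 : ℝ) 1, HasDerivAt N
      (-((finrank ℝ E - 2) / t + b t * t) * N t + (finrank ℝ E - 1) / t * M t) t := by
    intro t ht
    simpa only [zero_add] using hμ.radial_ode hv heq 0 e ht
  -- Here `N t / t = M'`, and the equations for `p` and `q` are exactly those that make `p M' + q M`
  -- constant.
  set J : ℝ → ℝ := fun t => p t * (N t / t) + q t * M t with hJ
  have hJd : ∀ t ∈ Set.Ioo (0 : ℝ) 1, HasDerivAt J 0 t := by
    intro t ht
    have ht0 : t ≠ 0 := ht.1.ne'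
    refine (((hp t ht).mul ((hNd t ht).fun_div (hasDerivAt_id t) ht0)).add
      ((hq t ht).mul (hMd t ⟨ht.1.le, ht.2⟩))).congr_deriv ?_
    rw [hNA]
    simp only [id]
    field_simp
    ring
  have hJconst : ∀ t ∈ Set.Ioo (0 : ℝ) 1, J t = J r := fun t ht =>
    (isOpen_Ioo.is_const_of_deriv_eq_zero isPreconnected_Ioo
      (fun x hx => (hJd x hx).differentiableAt.differentiableWithinAt)
      (fun x hx => (hJd x hx).deriv) ht hr)
  have hA0 : finrank ℝ E * A 0 = fderiv ℝ v 0 e := by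
    have := hμ.integral_inner_mul_inner e (sharp E (fderiv ℝ v 0))
    rw [inner_sharp] at this
    rw [← this, hA]
    simp only [zero_smul]
    congr 2; ext η
    rw [real_inner_comm _ (sharp E _), inner_sharp]
  have hM0 : M 0 = 0 := by
    have := hμ.integral_inner hd e
    simp only [hM, zero_smul]
    rw [integral_mul_const, this, zero_mul]
  have hN0 : N 0 = 0 := by simp [hN]
  have hNd0 : HasDerivAt N (A 0) 0 := by
    refine (hμ.hasDerivAt_radial hv.fderiv_apply_self
      (Y := fun η => inner ℝ e η) (by fun_prop) (by simp)).congr_deriv ?_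
    simp only [hA]
    congr 1; ext η
    rw [hv.fderiv_fderiv_apply_self (by simp)]
    simp
  -- Both `N t / t` and `M t / t` tend to `A 0`, so the normalizations of `p` and `t q` add up to
  -- `finrank ℝ E * A 0 = D_e v(0)`.
  have hlim : Tendsto J (𝓝[>] 0) (𝓝 (1 * A 0 + (finrank ℝ E - 1) * A 0)) := by
    have h1 := hNd0.tendsto_slope_zero_right
    have h2 := (hMd 0 (by simp)).tendsto_slope_zero_right
    refine ((hp0.mul h1).add (hq0.mul h2)).congr' ?_
    filter_upwards [self_mem_nhdsWithin] with t ht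
    have ht0 : t ≠ 0 := ne_of_gt ht
    simp only [hJ, zero_add, hN0, hM0, sub_zero, smul_eq_mul]
    field_simp
  have hlim2 : Tendsto J (𝓝[>] 0) (𝓝 (J r)) := by
    refine tendsto_const_nhds.congr' ?_
    filter_upwards [Ioo_mem_nhdsGT one_pos] with t ht
    exact (hJconst t ht).symm
  have h3 := tendsto_nhds_unique hlim2 hlim
  have h4 : J r = p r * A r + q r * M r := by
    have : r ≠ 0 := hr.1.ne'
    simp only [hJ, hNA]
    field_simp
  rw [← h4, h3, ← hA0]
  ring

end RadialODE

/-! ### The endpoint argument at `r = 1`. -/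

/-- A bounded solution of `p M' + q M = D` on `(0, 1)`, with `p` vanishing at `1`, forces
`D ≤ q(1) sup M`. -/
theorem le_mul_of_singular_ode {p q M M' : ℝ → ℝ} {C D K κ : ℝ}
    (hp : ∀ r ∈ Set.Ioo (0 : ℝ) 1, 0 < p r ∧ p r ≤ C * (1 - r))
    (hq : ∀ r ∈ Set.Ioo (0 : ℝ) 1, 0 ≤ q r) (hq1 : Tendsto q (𝓝[<] 1) (𝓝 κ))
    (hM : ∀ r ∈ Set.Ioo (0 : ℝ) 1, HasDerivAt M (M' r) r)
    (hD : ∀ r ∈ Set.Ioo (0 : ℝ) 1, p r * M' r + q r * M r = D)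
    (hK : ∀ r ∈ Set.Ioo (0 : ℝ) 1, M r ≤ K) : D ≤ κ * K := by
  by_contra! hlt
  obtain ⟨ε, hε, hεD⟩ : ∃ ε > 0, κ * K < D - ε := ⟨(D - κ * K) / 2, by linarith, by linarith⟩
  have hC : 0 < C := by
    have := hp (1 / 2) (by norm_num)
    linarith
  have h1 : ∀ᶠ r in 𝓝[<] (1 : ℝ), q r * K < D - ε := (hq1.mul_const K).eventually_lt_const hεD
  obtain ⟨r₀, hr₀, hsub⟩ := (mem_nhdsLT_iff_exists_Ioo_subset' (zero_lt_one (α := ℝ))).1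
    (h1.and (Ioo_mem_nhdsLT (zero_lt_one (α := ℝ))))
  -- Near `1` one has `p M' ≥ ε`, hence `M' ≥ (ε / C) / (1 - r)`. This is not integrable, so `M`
  -- would grow logarithmically past `K`.
  have hder : ∀ r ∈ Set.Ioo r₀ 1, HasDerivAt (fun r => M r + ε / C * Real.log (1 - r))
      (M' r - ε / C / (1 - r)) r := by
    intro r hr
    have h2 := (hM r (hsub hr).2).add ((((hasDerivAt_id r).const_sub 1).log
      (by simp only [id]; linarith [hr.2])).const_mul (ε / C))
    refine h2.congr_deriv ?_
    simp only [id]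
    ring
  have hmono : MonotoneOn (fun r => M r + ε / C * Real.log (1 - r)) (Set.Ioo r₀ 1) := by
    refine monotoneOn_of_deriv_nonneg (convex_Ioo _ _)
      (fun r hr => (hder r hr).continuousAt.continuousWithinAt)
      (fun r hr => (hder r (interior_subset hr)).differentiableAt.differentiableWithinAt) ?_
    intro r hr
    rw [interior_Ioo] at hr
    rw [(hder r hr).deriv, sub_nonneg]
    obtain ⟨h3, h4⟩ := hsub hr
    have h5 := hD r h4
    have h6 := mul_le_mul_of_nonneg_left (hK r h4) (hq r h4)
    obtain ⟨h7, h8⟩ := hp r h4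
    have h9 : ε ≤ p r * M' r := by linarith [show q r * K < D - ε from h3]
    have h10 : 0 < M' r := pos_of_mul_pos_right (hε.trans_le h9) h7.le
    rw [div_div, div_le_iff₀ (mul_pos hC (by linarith [hr.2]))]
    nlinarith
  obtain ⟨a, ha⟩ : (Set.Ioo r₀ 1).Nonempty := Set.nonempty_Ioo.2 hr₀
  have hbot : Tendsto (fun r => K + ε / C * Real.log (1 - r)) (𝓝[<] 1) atBot := by
    refine tendsto_atBot_add_const_left _ _ ((Tendsto.const_mul_atBot (by positivity)) ?_)
    refine Real.tendsto_log_nhdsGT_zero.comp ?_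
    refine tendsto_nhdsWithin_iff.2 ⟨?_, ?_⟩
    · have : Tendsto (fun r : ℝ => 1 - r) (𝓝 1) (𝓝 (1 - 1)) := by
        exact tendsto_const_nhds.sub tendsto_id
      rw [sub_self] at this
      exact this.mono_left nhdsWithin_le_nhds
    · filter_upwards [self_mem_nhdsWithin] with r hr
      simpa using hr
  have h11 := hbot.eventually_lt_atBot (M a + ε / C * Real.log (1 - a))
  obtain ⟨r, h12, h13⟩ := (h11.and (Ioo_mem_nhdsLT ha.2)).exists
  have hr' : r ∈ Set.Ioo r₀ 1 := ⟨ha.1.trans h13.1, h13.2⟩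
  have h14 := hmono ha hr' h13.1.le
  have h15 := hK r (hsub hr').2
  simp only at h14
  linarith

/-! ### The gradient bound at the origin. -/

section Center

variable {E : Type*} [NormedAddCommGroup E] [InnerProductSpace ℝ E] [FiniteDimensional ℝ E]
  {v : E → ℝ}

theorem fderiv_center_bound (hd : 3 ≤ finrank ℝ E)
    (hv : ContDiffOn ℝ 2 v (ball 0 1)) (hv1 : ∀ x ∈ ball (0 : E) 1, |v x| < 1) {b p q : ℝ → ℝ}
    (hb : ∀ r ∈ Set.Ioo (0 : ℝ) 1, 0 ≤ b r)
    (heq : ∀ x ∈ ball (0 : E) 1, Laplacian.laplacian v x + b ‖x‖ * fderiv ℝ v x x = 0)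
    (hp : ∀ r ∈ Set.Ioo (0 : ℝ) 1,
      HasDerivAt p (p r * ((finrank ℝ E - 1) / r + b r * r) - q r) r)
    (hq : ∀ r ∈ Set.Ioo (0 : ℝ) 1, HasDerivAt q (-(p r * (finrank ℝ E - 1) / r ^ 2)) r)
    (hp0 : Tendsto p (𝓝[>] 0) (𝓝 1))
    (hq0 : Tendsto (fun r => r * q r) (𝓝[>] 0) (𝓝 (finrank ℝ E - 1)))
    {C κ : ℝ} (hp1 : ∀ r ∈ Set.Ioo (0 : ℝ) 1, 0 < p r ∧ p r ≤ C * (1 - r))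
    (hq1 : ∀ r ∈ Set.Ioo (0 : ℝ) 1, 0 ≤ q r) (hκ : Tendsto q (𝓝[<] 1) (𝓝 κ)) (hκ0 : 0 < κ)
    {e : E} (he : ‖e‖ = 1) :
    fderiv ℝ v 0 e ≤ κ / 2 * (1 - v 0 ^ 2) ∧
      (4 ≤ finrank ℝ E → fderiv ℝ v 0 e < κ / 2 * (1 - v 0 ^ 2)) := by
  let : MeasurableSpace E := borel E
  have : BorelSpace E := ⟨rfl⟩
  have : Nontrivial E := nontrivial_of_finrank_pos (R := ℝ) (by omega)
  obtain ⟨μ, hμ⟩ := exists_isUniformOnSphere E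
  have hd' : (3 : ℝ) ≤ finrank ℝ E := by exact_mod_cast hd
  have ha : |-v 0| < 1 := by rw [abs_neg]; exact hv1 0 (by simp)
  obtain ⟨δ, hδ, hΦ⟩ := hμ.exists_integral_abs_inner_sub_le hd he ha
  -- By the mean value property, adding `v 0` to the weight `⟨e, η⟩` adds exactly `v 0 ^ 2` to the
  -- integral. The shift makes the estimate `|v| < 1` sharp enough.
  have hK : ∀ r ∈ Set.Ioo (0 : ℝ) 1, ∫ η, inner ℝ e η * v (r • η) ∂μ ≤
      ∫ η, |inner ℝ e η - -v 0| ∂μ - v 0 ^ 2 := by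
    intro r hr
    have habs : |r| < 1 := by rw [abs_of_pos hr.1]; exact hr.2
    have hmem : Set.MapsTo (fun η : E => r • η) (sphere 0 1) (ball 0 1) :=
      fun η hη => smul_mem_ball_of_mem_sphere habs hη
    have hc0 : ContinuousOn (fun η => v (r • η)) (sphere 0 1) :=
      hv.continuousOn.comp (by fun_prop) hmem
    have hmean := hμ.integral_eq_center (by omega) hv hb heq ⟨hr.1.le, hr.2⟩
    have h1 : ∫ η, inner ℝ e η * v (r • η) ∂μ + v 0 ^ 2 =
        ∫ η, inner ℝ e η * v (r • η) + v 0 * v (r • η) ∂μ := by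
      have i1 : Integrable (fun η => inner ℝ e η * v (r • η)) μ :=
        hμ.integrable ((by fun_prop : ContinuousOn (fun η : E => inner ℝ e η) _).mul hc0)
      rw [integral_add i1 ((hμ.integrable hc0).const_mul _), integral_const_mul, hmean, sq]
    have h2 : ∫ η, inner ℝ e η * v (r • η) + v 0 * v (r • η) ∂μ ≤
        ∫ η, |inner ℝ e η - -v 0| ∂μ := by
      refine hμ.integral_mono (((by fun_prop : ContinuousOn (fun η : E => inner ℝ e η) _).mul
        hc0).add (continuousOn_const.mul hc0)) (by fun_prop) fun η hη => ?_
      rw [← add_mul, sub_neg_eq_add]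
      refine (le_abs_self _).trans ?_
      rw [abs_mul]
      exact mul_le_of_le_one_right (abs_nonneg _) (hv1 _ (hmem hη)).le
    linarith
  have hD := le_mul_of_singular_ode hp1 hq1 hκ
    (fun r hr => hμ.hasDerivAt_radial (hv.of_le (by norm_num)) (Y := fun η => inner ℝ e η)
      (by fun_prop) (by rw [abs_of_pos hr.1]; exact hr.2))
    (fun r hr => hμ.fderiv_center_eq (by omega) hv heq hp hq hp0 hq0 e hr) hK
  have hle : ∫ η, |inner ℝ e η - -v 0| ∂μ - v 0 ^ 2 ≤
      (1 - v 0 ^ 2) / 2 - (finrank ℝ E - 3) * δ := by linarith [neg_sq (v 0)]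
  have hD2 := hD.trans (mul_le_mul_of_nonneg_left hle hκ0.le)
  constructor
  · have := mul_nonneg hκ0.le (mul_nonneg (sub_nonneg.2 hd') hδ.le)
    linarith
  · intro h4
    have h4' : (4 : ℝ) ≤ finrank ℝ E := by exact_mod_cast h4
    have : 0 < κ * ((finrank ℝ E - 3) * δ) := mul_pos hκ0 (mul_pos (by linarith) hδ)
    linarith

/-- With `b = 0` and `k = n - 1`, the adjoint pair that is normalized at `0` and has `p 1 = 0` is `p
= 1 - r^n`, `q = k / r + r^k`, so `κ = n`. Bernoulli's inequality gives `p ≤ n (1 - r)`. -/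
theorem fderiv_center_bound_of_harmonic (hd : 3 ≤ finrank ℝ E)
    (hv : ContDiffOn ℝ 2 v (ball 0 1)) (hv1 : ∀ x ∈ ball (0 : E) 1, |v x| < 1)
    (heq : ∀ x ∈ ball (0 : E) 1, Laplacian.laplacian v x = 0) {e : E} (he : ‖e‖ = 1) :
    fderiv ℝ v 0 e ≤ (finrank ℝ E : ℝ) / 2 * (1 - v 0 ^ 2) ∧
      (4 ≤ finrank ℝ E → fderiv ℝ v 0 e < (finrank ℝ E : ℝ) / 2 * (1 - v 0 ^ 2)) := by
  obtain ⟨k, hk⟩ : ∃ k, finrank ℝ E = k + 1 := ⟨finrank ℝ E - 1, by omega⟩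
  have hk0 : k ≠ 0 := by omega
  refine fderiv_center_bound hd hv hv1 (b := fun _ => 0) (p := fun r => 1 - r ^ (k + 1))
    (q := fun r => k / r + r ^ k) (C := k + 1) (fun _ _ => le_rfl)
    (fun x hx => by rw [heq x hx]; ring) ?_ ?_ ?_ ?_ ?_ ?_ ?_ (by positivity) he
  · intro r hr
    have hr0 : r ≠ 0 := hr.1.ne'
    refine ((hasDerivAt_pow (k + 1) r).const_sub 1).congr_deriv ?_
    rw [hk]
    push_cast
    field_simp
    simp
    ring
  · intro r hr
    have hr0 : r ≠ 0 := hr.1.ne'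
    obtain ⟨j, rfl⟩ := Nat.exists_eq_succ_of_ne_zero hk0
    refine (((hasDerivAt_const r ((j + 1 : ℕ) : ℝ)).div (hasDerivAt_id r) hr0).add
      (hasDerivAt_pow (j + 1) r)).congr_deriv ?_
    rw [hk]
    push_cast
    simp only [id]
    field_simp
    simp
    ring
  · have : Tendsto (fun r : ℝ => 1 - r ^ (k + 1)) (𝓝 0) (𝓝 (1 - 0 ^ (k + 1))) :=
      (by fun_prop : Continuous fun r : ℝ => 1 - r ^ (k + 1)).tendsto 0
    simp only [ne_eq, Nat.add_eq_zero_iff, one_ne_zero, and_false, not_false_eq_true, zero_pow,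
      sub_zero] at this
    exact this.mono_left nhdsWithin_le_nhds
  · have : Tendsto (fun r : ℝ => k + r ^ (k + 1)) (𝓝 0) (𝓝 (k + 0 ^ (k + 1))) :=
      (by fun_prop : Continuous fun r : ℝ => k + r ^ (k + 1)).tendsto 0
    have h2 : (finrank ℝ E - 1 : ℝ) = k + 0 ^ (k + 1) := by rw [hk]; simp
    rw [h2]
    refine (this.mono_left nhdsWithin_le_nhds).congr' ?_
    filter_upwards [self_mem_nhdsWithin] with r hr
    have hr0 : r ≠ 0 := ne_of_gt hr
    field_simp
    ring
  · intro r hr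
    refine ⟨sub_pos.2 (pow_lt_one₀ hr.1.le hr.2 (by omega)), ?_⟩
    have := one_add_mul_le_pow (a := r - 1) (by linarith [hr.1]) (k + 1)
    push_cast at this
    rw [add_sub_cancel] at this
    linarith
  · intro r hr
    have := hr.1
    positivity
  · have : ContinuousAt (fun r : ℝ => k / r + r ^ k) 1 := by
      fun_prop (disch := norm_num)
    have h1 := this.tendsto.mono_left (nhdsWithin_le_nhds (s := Set.Iio 1))
    rw [hk]
    push_cast
    simpa using h1

/-- Dividing the equation by `(1 - |x|²)²` gives `b = 2 (n - 2) / (1 - r²)`. The adjoint pair is `p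
= 1 - r²`, `q = (n - 1)(1/r + r)`, so `κ = 2 (n - 1)`. -/
theorem fderiv_center_bound_of_hyperbolic (hd : 3 ≤ finrank ℝ E)
    (hv : ContDiffOn ℝ 2 v (ball 0 1)) (hv1 : ∀ x ∈ ball (0 : E) 1, |v x| < 1)
    (heq : ∀ x ∈ ball (0 : E) 1, (1 - ‖x‖ ^ 2) ^ 2 * Laplacian.laplacian v x +
      2 * (finrank ℝ E - 2) * (1 - ‖x‖ ^ 2) * fderiv ℝ v x x = 0) {e : E} (he : ‖e‖ = 1) :
    fderiv ℝ v 0 e ≤ ((finrank ℝ E : ℝ) - 1) * (1 - v 0 ^ 2) ∧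
      (4 ≤ finrank ℝ E → fderiv ℝ v 0 e < ((finrank ℝ E : ℝ) - 1) * (1 - v 0 ^ 2)) := by
  have hd' : (3 : ℝ) ≤ finrank ℝ E := by exact_mod_cast hd
  have hsq : ∀ r ∈ Set.Ioo (0 : ℝ) 1, 0 < 1 - r ^ 2 := fun r hr => by nlinarith [hr.1, hr.2]
  have hκ : ((finrank ℝ E : ℝ) - 1) = (2 * (finrank ℝ E - 1)) / 2 := by ring
  rw [hκ]
  refine fderiv_center_bound hd hv hv1 (b := fun r => 2 * (finrank ℝ E - 2) / (1 - r ^ 2))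
    (p := fun r => 1 - r ^ 2)
    (q := fun r => (finrank ℝ E - 1) * (r⁻¹ + r)) (C := 2) ?_ ?_ ?_ ?_ ?_ ?_ ?_ ?_ ?_
    (by linarith) he
  · intro r hr
    have := hsq r hr
    exact div_nonneg (by linarith) this.le
  · intro x hx
    have h1 := heq x hx
    have h2 : ‖x‖ < 1 := by simpa using hx
    have h3 : 0 < 1 - ‖x‖ ^ 2 := by nlinarith [norm_nonneg x]
    have h4 : (1 - ‖x‖ ^ 2) ^ 2 * (Laplacian.laplacian v x +
      2 * (finrank ℝ E - 2) / (1 - ‖x‖ ^ 2) * fderiv ℝ v x x) = 0 := by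
      rw [← h1]
      field_simp
    exact (mul_eq_zero.1 h4).resolve_left (by positivity)
  · intro r hr
    have hr0 : r ≠ 0 := hr.1.ne'
    have := (hsq r hr).ne'
    refine ((hasDerivAt_pow 2 r).const_sub 1).congr_deriv ?_
    field_simp
    push_cast
    ring
  · intro r hr
    have hr0 : r ≠ 0 := hr.1.ne'
    refine (((hasDerivAt_inv hr0).add (hasDerivAt_id r)).const_mul _).congr_deriv ?_
    field_simp
    ring
  · have : Tendsto (fun r : ℝ => 1 - r ^ 2) (𝓝 0) (𝓝 (1 - 0 ^ 2)) :=
      (by fun_prop : Continuous fun r : ℝ => 1 - r ^ 2).tendsto 0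
    simpa using this.mono_left (nhdsWithin_le_nhds (s := Set.Ioi 0))
  · have : Tendsto (fun r : ℝ => ((finrank ℝ E : ℝ) - 1) * (1 + r ^ 2)) (𝓝 0)
        (𝓝 (((finrank ℝ E : ℝ) - 1) * (1 + 0 ^ 2))) :=
      (by fun_prop : Continuous fun r : ℝ => ((finrank ℝ E : ℝ) - 1) * (1 + r ^ 2)).tendsto 0
    have h2 : (finrank ℝ E - 1 : ℝ) = (finrank ℝ E - 1) * (1 + 0 ^ 2) := by ring
    conv => enter [3, 1]; rw [h2]
    refine (this.mono_left nhdsWithin_le_nhds).congr' ?_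
    filter_upwards [self_mem_nhdsWithin] with r hr
    have hr0 : r ≠ 0 := ne_of_gt hr
    field_simp
  · intro r hr
    refine ⟨hsq r hr, ?_⟩
    nlinarith [hr.1, hr.2]
  · intro r hr
    have := hr.1
    exact mul_nonneg (by linarith) (by positivity)
  · have : ContinuousAt (fun r : ℝ => ((finrank ℝ E : ℝ) - 1) * (r⁻¹ + r)) 1 := by
      fun_prop (disch := norm_num)
    have h1 := this.tendsto.mono_left (nhdsWithin_le_nhds (s := Set.Iio 1))
    have h2 : (2 * (finrank ℝ E - 1) : ℝ) = (finrank ℝ E - 1) * (1⁻¹ + 1) := by ring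
    rwa [h2]

end Center

/-! ### Conformal changes of variable and the Laplacian of an inversion. -/

section Conformal

variable {E : Type*} [NormedAddCommGroup E] [InnerProductSpace ℝ E] [FiniteDimensional ℝ E]

/-- The Laplacian of a composition with a map that is conformal at the point. -/
theorem laplacian_comp_of_conformal {g : E → ℝ} {φ : E → E} {y : E} {l : ℝ} (A : E ≃ₗᵢ[ℝ] E)
    (hg : ContDiffAt ℝ 2 g (φ y)) (hφ : ContDiffAt ℝ 2 φ y)
    (hA : fderiv ℝ φ y = l • (A : E →L[ℝ] E)) :
    Laplacian.laplacian (g ∘ φ) y =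
      l ^ 2 * Laplacian.laplacian g (φ y) + fderiv ℝ g (φ y) (Laplacian.laplacian φ y) := by
  have hg1 : HasFDerivAt (fderiv ℝ g) (fderiv ℝ (fderiv ℝ g) (φ y)) (φ y) :=
    ((hg.fderiv_right (m := 1) (by norm_num)).differentiableAt one_ne_zero).hasFDerivAt
  have hφ1 : HasFDerivAt (fderiv ℝ φ) (fderiv ℝ (fderiv ℝ φ) y) y :=
    ((hφ.fderiv_right (m := 1) (by norm_num)).differentiableAt one_ne_zero).hasFDerivAt
  have hφ0 : HasFDerivAt φ (fderiv ℝ φ y) y := (hφ.differentiableAt two_ne_zero).hasFDerivAt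
  have hev : fderiv ℝ (g ∘ φ) =ᶠ[𝓝 y] fun x => (fderiv ℝ g (φ x)).comp (fderiv ℝ φ x) := by
    filter_upwards [hφ.eventually (by simp), hφ.continuousAt.eventually (hg.eventually (by simp))]
      with x h1 h2
    exact fderiv_comp x (h2.differentiableAt two_ne_zero) (h1.differentiableAt two_ne_zero)
  have h2 : ∀ h k, fderiv ℝ (fderiv ℝ (g ∘ φ)) y h k =
      fderiv ℝ (fderiv ℝ g) (φ y) (fderiv ℝ φ y h) (fderiv ℝ φ y k) +
        fderiv ℝ g (φ y) (fderiv ℝ (fderiv ℝ φ) y h k) := by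
    intro h k
    have h3 : HasFDerivAt (fun x => (fderiv ℝ g (φ x)).comp (fderiv ℝ φ x)) _ y :=
      (hg1.comp y hφ0).clm_comp hφ1
    rw [hev.fderiv_eq, h3.fderiv]
    simp [add_comm]
  -- The Laplacian of `g` is computed in the basis rotated by `A`, so that the terms `D²g (Dφ e, Dφ
  -- e)` match one by one.
  rw [laplacian_eq_sum_fderiv_fderiv (stdOrthonormalBasis ℝ E) (g ∘ φ),
    laplacian_eq_sum_fderiv_fderiv (stdOrthonormalBasis ℝ E) φ,
    laplacian_eq_sum_fderiv_fderiv ((stdOrthonormalBasis ℝ E).map A) g]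
  simp [h2, hA, Finset.sum_add_distrib, Finset.mul_sum, sq, mul_assoc]

omit [FiniteDimensional ℝ E] in
open EuclideanGeometry in
theorem fderiv_inversion_apply {c x : E} (R : ℝ) (hx : x ≠ c) (k : E) :
    fderiv ℝ (inversion c R) x k = (R ^ 2 * (‖x - c‖ ^ 2)⁻¹) • k -
      (2 * R ^ 2 * inner ℝ (x - c) k * ((‖x - c‖ ^ 2) ^ 2)⁻¹) • (x - c) := by
  have h0 : ‖x - c‖ ≠ 0 := norm_ne_zero_iff.2 (sub_ne_zero.2 hx)
  rw [(hasFDerivAt_inversion hx).fderiv]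
  simp only [smul_apply, dist_eq_norm]
  have : (ℝ ∙ (x - c))ᗮ.reflection k = k - (2 * inner ℝ (x - c) k / ‖x - c‖ ^ 2) • (x - c) := by
    rw [Submodule.reflection_orthogonal_apply, Submodule.reflection_singleton_apply]
    simp only [RCLike.ofReal_real_eq_id, id, neg_sub, two_smul, ← add_smul]
    congr 2
    ring
  have h1 : ((ℝ ∙ (x - c))ᗮ.reflection : E →L[ℝ] E) k = (ℝ ∙ (x - c))ᗮ.reflection k := rfl
  rw [h1, this, smul_sub, smul_smul]
  congr 2
  · field_simp
  · field_simp

omit [FiniteDimensional ℝ E] in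
open EuclideanGeometry in
theorem contDiffAt_inversion {c x : E} (R : ℝ) (hx : x ≠ c) : ContDiffAt ℝ 2 (inversion c R) x :=
  contDiffAt_const.inversion contDiffAt_const contDiffAt_id hx

omit [FiniteDimensional ℝ E] in
theorem hasDerivAt_fderiv_inversion_line {z k : E} (R : ℝ) (hz : z ≠ 0) (hk : ‖k‖ = 1) :
    HasDerivAt (fun t : ℝ => (R ^ 2 * (‖z + t • k‖ ^ 2)⁻¹) • k -
        (2 * R ^ 2 * inner ℝ (z + t • k) k * ((‖z + t • k‖ ^ 2) ^ 2)⁻¹) • (z + t • k))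
      ((R ^ 2 * ((‖z‖ ^ 2) ^ 2)⁻¹) • (-(4 : ℝ) • ((inner ℝ k z : ℝ) • k) - (2 : ℝ) • z
        + (8 * (inner ℝ k z * inner ℝ z k) * (‖z‖ ^ 2)⁻¹ : ℝ) • z)) 0 := by
  have hz0 : ‖z‖ ≠ 0 := norm_ne_zero_iff.2 hz
  have hzl : HasDerivAt (fun t : ℝ => z + t • k) k 0 := by
    simpa using ((hasDerivAt_id (0 : ℝ)).smul_const k).const_add z
  have hN : HasDerivAt (fun t : ℝ => ‖z + t • k‖ ^ 2) (2 * inner ℝ z k) 0 := by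
    have := hzl.norm_sq
    simpa using this
  have hI : HasDerivAt (fun t : ℝ => (inner ℝ (z + t • k) k : ℝ)) 1 0 := by
    have := hzl.inner ℝ (hasDerivAt_const (0 : ℝ) k)
    simpa [hk] using this
  have hne : ‖z + (0 : ℝ) • k‖ ^ 2 ≠ 0 := by simpa using hz
  have h4 := (((hN.fun_inv hne).const_mul (R ^ 2)).smul_const k).fun_sub
    (((hI.const_mul (2 * R ^ 2)).fun_mul ((hN.fun_pow 2).fun_inv (pow_ne_zero 2 hne))).fun_smul hzl)
  refine h4.congr_deriv ?_
  simp only [zero_smul, add_zero, real_inner_comm k z]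
  match_scalars
  · field_simp
    ring
  · field_simp
    ring

-- Only diagonal second derivatives enter the Laplacian, so differentiating the explicit first
-- derivative along the line `y + t k` suffices.
omit [FiniteDimensional ℝ E] in
open EuclideanGeometry in
theorem fderiv_fderiv_inversion_apply {c y k : E} (R : ℝ) (hy : y ≠ c) (hk : ‖k‖ = 1) :
    fderiv ℝ (fderiv ℝ (inversion c R)) y k k =
      (R ^ 2 * ((‖y - c‖ ^ 2) ^ 2)⁻¹) • (-(4 : ℝ) • ((inner ℝ k (y - c) : ℝ) • k)
        - (2 : ℝ) • (y - c)
        + (8 * (inner ℝ k (y - c) * inner ℝ (y - c) k) * (‖y - c‖ ^ 2)⁻¹ : ℝ) • (y - c)) := by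
  have hline : HasDerivAt (fun t : ℝ => y + t • k) k 0 := by
    simpa using ((hasDerivAt_id (0 : ℝ)).smul_const k).const_add y
  have h1 : HasDerivAt (fun t : ℝ => fderiv ℝ (inversion c R) (y + t • k) k)
      (fderiv ℝ (fderiv ℝ (inversion c R)) y k k) 0 := by
    have h2 : HasFDerivAt (fderiv ℝ (inversion c R)) (fderiv ℝ (fderiv ℝ (inversion c R)) y)
        (y + (0 : ℝ) • k) := by
      rw [zero_smul, add_zero]
      exact (((contDiffAt_inversion R hy).fderiv_right (m := 1) (by norm_num)).differentiableAt
        one_ne_zero).hasFDerivAt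
    exact ((ContinuousLinearMap.apply ℝ E k).hasFDerivAt).comp_hasDerivAt 0
      (h2.comp_hasDerivAt 0 hline)
  have hev : (fun t : ℝ => fderiv ℝ (inversion c R) (y + t • k) k) =ᶠ[𝓝 0] fun t =>
      (R ^ 2 * (‖y - c + t • k‖ ^ 2)⁻¹) • k -
    (2 * R ^ 2 * inner ℝ (y - c + t • k) k * ((‖y - c + t • k‖ ^ 2) ^ 2)⁻¹) • (y - c + t • k) := by
    have hne' : ∀ᶠ t : ℝ in 𝓝 0, y + t • k ≠ c := by
      refine hline.continuousAt.eventually_ne ?_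
      simpa using hy
    filter_upwards [hne'] with t ht
    rw [fderiv_inversion_apply R ht, add_sub_right_comm]
  exact h1.unique ((hasDerivAt_fderiv_inversion_line R (sub_ne_zero.2 hy) hk).congr_of_eventuallyEq
    hev)

open EuclideanGeometry in
theorem laplacian_inversion {c y : E} (R : ℝ) (hy : y ≠ c) :
    Laplacian.laplacian (inversion c R) y =
      (-(2 * (finrank ℝ E - 2)) * R ^ 2 * ((‖y - c‖ ^ 2) ^ 2)⁻¹) • (y - c) := by
  have hz0 : ‖y - c‖ ≠ 0 := norm_ne_zero_iff.2 (sub_ne_zero.2 hy)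
  rw [laplacian_eq_sum_fderiv_fderiv (stdOrthonormalBasis ℝ E)]
  simp only [fderiv_fderiv_inversion_apply R hy ((stdOrthonormalBasis ℝ E).orthonormal.1 _)]
  rw [← Finset.smul_sum, Finset.sum_add_distrib, Finset.sum_sub_distrib, ← Finset.smul_sum,
    (stdOrthonormalBasis ℝ E).sum_repr']
  simp only [← Finset.sum_smul, ← Finset.sum_mul, ← Finset.mul_sum]
  have h5 : ∑ j, inner ℝ (stdOrthonormalBasis ℝ E j) (y - c) *
      inner ℝ (y - c) (stdOrthonormalBasis ℝ E j) = ‖y - c‖ ^ 2 := by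
    rw [← real_inner_self_eq_norm_sq,
      ← (stdOrthonormalBasis ℝ E).sum_inner_mul_inner (y - c) (y - c)]
    simp only [mul_comm]
  rw [h5, Finset.sum_const, Finset.card_univ, Fintype.card_fin]
  generalize y - c = z at *
  match_scalars
  field_simp
  ring

end Conformal

/-! ### Scalar gradient bounds at an arbitrary point. -/

section ScalarBounds

variable {E : Type*} [NormedAddCommGroup E] [InnerProductSpace ℝ E] [FiniteDimensional ℝ E]
  {u : E → ℝ}

/-- Rescaling the ball of radius `1 - |x|` around `x` to the unit ball preserves harmonicity and
multiplies the gradient at the center by `1 - |x|`. -/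
theorem fderiv_bound_of_harmonic (hd : 3 ≤ finrank ℝ E)
    (hu : ContDiffOn ℝ 2 u (ball 0 1)) (hu1 : ∀ x ∈ ball (0 : E) 1, |u x| < 1)
    (heq : ∀ x ∈ ball (0 : E) 1, Laplacian.laplacian u x = 0) {x : E} (hx : x ∈ ball (0 : E) 1)
    {β : E} (hβ : ‖β‖ = 1) :
    fderiv ℝ u x β ≤ (finrank ℝ E : ℝ) / 2 / (1 - ‖x‖) * (1 - u x ^ 2) ∧
      (4 ≤ finrank ℝ E →
        fderiv ℝ u x β < (finrank ℝ E : ℝ) / 2 / (1 - ‖x‖) * (1 - u x ^ 2)) := by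
  have hx1 : ‖x‖ < 1 := by simpa using hx
  have hρ : 0 < 1 - ‖x‖ := by linarith
  set ρ := 1 - ‖x‖ with hρd
  set φ : E → E := fun y => x + ρ • y with hφ
  have hmaps : Set.MapsTo φ (ball 0 1) (ball 0 1) := by
    intro y hy
    have hy1 : ‖y‖ < 1 := by simpa using hy
    have : ‖φ y‖ < 1 := calc
      ‖x + ρ • y‖ ≤ ‖x‖ + ‖ρ • y‖ := norm_add_le _ _
      _ = ‖x‖ + ρ * ‖y‖ := by rw [norm_smul, Real.norm_eq_abs, abs_of_pos hρ]
      _ < 1 := by nlinarith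
    simpa using this
  have hφc : ContDiff ℝ 2 φ := by fun_prop
  have hφd : ∀ y, HasFDerivAt φ (ρ • ((LinearIsometryEquiv.refl ℝ E : E ≃ₗᵢ[ℝ] E) : E →L[ℝ] E)) y := by
    intro y
    exact ((hasFDerivAt_id y).const_smul ρ).const_add x
  have hφ2 : ∀ y, Laplacian.laplacian φ y = 0 := by
    intro y
    rw [laplacian_eq_sum_fderiv_fderiv (stdOrthonormalBasis ℝ E)]
    have : fderiv ℝ φ = fun _ => ρ • ((LinearIsometryEquiv.refl ℝ E : E ≃ₗᵢ[ℝ] E) : E →L[ℝ] E) :=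
      funext fun y => (hφd y).fderiv
    simp [this]
  have hua : ∀ y ∈ ball (0 : E) 1, ContDiffAt ℝ 2 u (φ y) := fun y hy =>
    hu.contDiffAt (isOpen_ball.mem_nhds (hmaps hy))
  have h0 : φ 0 = x := by simp [hφ]
  have hmain := fderiv_center_bound_of_harmonic hd (hu.comp hφc.contDiffOn hmaps)
    (fun y hy => hu1 _ (hmaps hy)) (fun y hy => by
      rw [laplacian_comp_of_conformal _ (hua y hy) hφc.contDiffAt (hφd y).fderiv, hφ2,
        heq _ (hmaps hy)]
      simp) hβ
  have hfd : fderiv ℝ (u ∘ φ) 0 β = ρ * fderiv ℝ u x β := by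
    rw [fderiv_comp 0 ((hua 0 (by simp)).differentiableAt two_ne_zero) (hφd 0).differentiableAt,
      (hφd 0).fderiv, h0]
    simp
  rw [hfd, Function.comp_apply, h0] at hmain
  have hval : (finrank ℝ E : ℝ) / 2 / ρ * (1 - u x ^ 2) =
      ((finrank ℝ E : ℝ) / 2 * (1 - u x ^ 2)) / ρ := by ring
  rw [hval, le_div_iff₀' hρ, lt_div_iff₀' hρ]
  exact hmain

open EuclideanGeometry in
/-- The hyperbolic reflection exchanging `0` and `a`: it pulls
hyperbolic harmonic functions back to hyperbolic harmonic functions. -/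
theorem exists_hyperbolic_reflection {a : E} (ha : a ∈ ball (0 : E) 1) (ha0 : a ≠ 0) :
    ∃ (φ : E → E) (l : E → ℝ) (A : E → E ≃ₗᵢ[ℝ] E), φ 0 = a ∧
      ∀ y ∈ ball (0 : E) 1, ContDiffAt ℝ 2 φ y ∧ φ y ∈ ball (0 : E) 1 ∧
        fderiv ℝ φ y = l y • (A y : E →L[ℝ] E) ∧
        l y * (1 - ‖y‖ ^ 2) = 1 - ‖φ y‖ ^ 2 ∧
        (1 - ‖y‖ ^ 2) ^ 2 • Laplacian.laplacian φ y +
          (2 * (finrank ℝ E - 2) * (1 - ‖y‖ ^ 2)) • fderiv ℝ φ y y =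
          (2 * (finrank ℝ E - 2) * (1 - ‖φ y‖ ^ 2)) • φ y := by
  have ha1 : ‖a‖ < 1 := by simpa using ha
  have ha2 : 0 < ‖a‖ := norm_pos_iff.2 ha0
  -- `c` is the mirror image of `a` in the unit sphere, and `R² = |c|² - 1` makes the sphere of
  -- inversion orthogonal to the unit sphere. The inversion thus preserves the ball and sends `0` to
  -- `a`.
  set c : E := (‖a‖ ^ 2)⁻¹ • a with hc
  have hcn : ‖c‖ = ‖a‖⁻¹ := by
    rw [hc, norm_smul, norm_inv, norm_pow, norm_norm]
    field_simp
  have hc1 : 1 < ‖c‖ := by rw [hcn]; exact (one_lt_inv₀ ha2).2 ha1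
  have hR0 : 0 < ‖c‖ ^ 2 - 1 := by nlinarith
  set R := √(‖c‖ ^ 2 - 1) with hR
  have hR2 : R ^ 2 = ‖c‖ ^ 2 - 1 := Real.sq_sqrt hR0.le
  refine ⟨inversion c R, fun y => (R / dist y c) ^ 2, fun y => (ℝ ∙ (y - c))ᗮ.reflection, ?_, ?_⟩
  · rw [inversion, dist_zero_left, div_pow, hR2]
    simp only [vsub_eq_sub, zero_sub, vadd_eq_add, smul_neg]
    have h1 : c - ((‖c‖ ^ 2 - 1) / ‖c‖ ^ 2) • c = (‖c‖ ^ 2)⁻¹ • c := by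
      match_scalars
      have : ‖c‖ ≠ 0 := by linarith
      field_simp
      ring
    rw [neg_add_eq_sub, h1, hcn, hc, smul_smul]
    have : (‖a‖⁻¹ ^ 2)⁻¹ * (‖a‖ ^ 2)⁻¹ = 1 := by field_simp
    rw [this, one_smul]
  · clear_value c
    intro y hy
    have hy1 : ‖y‖ < 1 := by simpa using hy
    have hyc : y ≠ c := by rintro rfl; linarith
    have hN0 : 0 < ‖y - c‖ := norm_pos_iff.2 (sub_ne_zero.2 hyc)
    have hφ : inversion c R y = c + (R ^ 2 * (‖y - c‖ ^ 2)⁻¹) • (y - c) := by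
      rw [inversion, dist_eq_norm, div_pow, vsub_eq_sub, vadd_eq_add, add_comm, div_eq_mul_inv]
    have hys : ‖y‖ ^ 2 = ‖y - c‖ ^ 2 + 2 * inner ℝ (y - c) c + ‖c‖ ^ 2 := by
      rw [← norm_add_sq_real, sub_add_cancel]
    have hid : (R / dist y c) ^ 2 * (1 - ‖y‖ ^ 2) = 1 - ‖inversion c R y‖ ^ 2 := by
      rw [hφ, norm_add_sq_real, norm_smul _ (y - c), mul_pow, inner_smul_right, real_inner_comm,
        Real.norm_eq_abs, sq_abs, dist_eq_norm, hys]
      have hc2 : ‖c‖ ^ 2 = R ^ 2 + 1 := by linarith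
      rw [hc2]
      field_simp
      ring
    refine ⟨contDiffAt_inversion R hyc, ?_, (hasFDerivAt_inversion hyc).fderiv, hid, ?_⟩
    · have h1 : 0 < 1 - ‖inversion c R y‖ ^ 2 := by
        rw [← hid]
        have : 0 < R := Real.sqrt_pos.2 hR0
        have h2 : 0 < dist y c := dist_pos.2 hyc
        have h3 : 0 < 1 - ‖y‖ ^ 2 := by nlinarith [norm_nonneg y]
        positivity
      have : ‖inversion c R y‖ < 1 := by nlinarith [norm_nonneg (inversion c R y)]
      simpa using this
    · rw [laplacian_inversion R hyc, fderiv_inversion_apply R hyc, ← hid, hφ, dist_eq_norm]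
      have hzy : inner ℝ (y - c) y = ‖y - c‖ ^ 2 + inner ℝ (y - c) c := by
        rw [← real_inner_self_eq_norm_sq, ← inner_add_right, sub_add_cancel]
      rw [hzy]
      have hin : (inner ℝ (y - c) c : ℝ) = (‖y‖ ^ 2 - ‖y - c‖ ^ 2 - ‖c‖ ^ 2) / 2 := by linarith
      have hc2 : ‖c‖ ^ 2 = R ^ 2 + 1 := by linarith
      rw [hin, hc2]
      obtain ⟨z, rfl⟩ : ∃ z, y = z + c := ⟨y - c, by simp⟩
      simp only [add_sub_cancel_right] at hN0 ⊢
      generalize ‖z + c‖ = s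
      generalize (finrank ℝ E : ℝ) = d
      match_scalars
      · field_simp
        ring
      · field_simp

theorem fderiv_bound_of_hyperbolic (hd : 3 ≤ finrank ℝ E)
    (hu : ContDiffOn ℝ 2 u (ball 0 1)) (hu1 : ∀ x ∈ ball (0 : E) 1, |u x| < 1)
    (heq : ∀ x ∈ ball (0 : E) 1, (1 - ‖x‖ ^ 2) ^ 2 * Laplacian.laplacian u x +
      2 * (finrank ℝ E - 2) * (1 - ‖x‖ ^ 2) * fderiv ℝ u x x = 0) {x : E}
    (hx : x ∈ ball (0 : E) 1) {β : E} (hβ : ‖β‖ = 1) :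
    fderiv ℝ u x β ≤ ((finrank ℝ E : ℝ) - 1) / (1 - ‖x‖ ^ 2) * (1 - u x ^ 2) ∧
      (4 ≤ finrank ℝ E →
        fderiv ℝ u x β < ((finrank ℝ E : ℝ) - 1) / (1 - ‖x‖ ^ 2) * (1 - u x ^ 2)) := by
  rcases eq_or_ne x 0 with rfl | hx0
  · simpa using fderiv_center_bound_of_hyperbolic hd hu hu1 heq hβ
  have hx1 : ‖x‖ < 1 := by simpa using hx
  have hρ : 0 < 1 - ‖x‖ ^ 2 := by nlinarith [norm_nonneg x]
  obtain ⟨φ, l, A, h0, hφ⟩ := exists_hyperbolic_reflection hx hx0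
  have hua : ∀ y ∈ ball (0 : E) 1, ContDiffAt ℝ 2 u (φ y) := fun y hy =>
    hu.contDiffAt (isOpen_ball.mem_nhds (hφ y hy).2.1)
  have hfd : ∀ y ∈ ball (0 : E) 1, fderiv ℝ (u ∘ φ) y = (fderiv ℝ u (φ y)).comp (fderiv ℝ φ y) :=
    fun y hy => fderiv_comp y ((hua y hy).differentiableAt two_ne_zero)
      ((hφ y hy).1.differentiableAt two_ne_zero)
  have hl0 : l 0 = 1 - ‖x‖ ^ 2 := by
    have := (hφ 0 (by simp)).2.2.2.1
    simpa [h0] using this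
  -- The direction is pulled back by `A 0`, so that `Dφ(0)` sends it to `l 0 • β` with `l 0 = 1 -
  -- |x|²`.
  have hmain := fderiv_center_bound_of_hyperbolic hd (v := u ∘ φ) (e := (A 0).symm β)
    (fun y hy => ((hua y hy).comp y (hφ y hy).1).contDiffWithinAt)
    (fun y hy => hu1 _ (hφ y hy).2.1) (fun y hy => by
      obtain ⟨h1, h2, h3, h4, h5⟩ := hφ y hy
      have h6 := congrArg (fderiv ℝ u (φ y)) h5
      simp only [map_add, map_smul, smul_eq_mul] at h6
      have h7 := heq _ h2
      rw [laplacian_comp_of_conformal _ (hua y hy) h1 h3, hfd y hy,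
        ContinuousLinearMap.comp_apply]
      rw [← h4] at h7 h6
      linear_combination h6 + h7) (by simpa using hβ)
  rw [hfd 0 (by simp), (hφ 0 (by simp)).2.2.1, Function.comp_apply, h0, hl0] at hmain
  simp only [ContinuousLinearMap.comp_apply, smul_apply, map_smul, smul_eq_mul] at hmain
  have hA : ((A 0 : E ≃ₗᵢ[ℝ] E) : E →L[ℝ] E) ((A 0).symm β) = β := (A 0).apply_symm_apply β
  rw [hA] at hmain
  have hval : ((finrank ℝ E : ℝ) - 1) / (1 - ‖x‖ ^ 2) * (1 - u x ^ 2) =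
      (((finrank ℝ E : ℝ) - 1) * (1 - u x ^ 2)) / (1 - ‖x‖ ^ 2) := by ring
  rw [hval, le_div_iff₀' hρ, lt_div_iff₀' hρ]
  exact hmain

end ScalarBounds

/-! ### From scalar bounds to `|∇|h||`. -/

section GradNorm

variable {E F : Type*} [NormedAddCommGroup E] [InnerProductSpace ℝ E] [FiniteDimensional ℝ E]
  [NormedAddCommGroup F] [InnerProductSpace ℝ F]

theorem ContinuousLinearMap.exists_norm_apply_eq [Nontrivial E] (A : E →L[ℝ] F) :
    ∃ β ∈ sphere (0 : E) 1, ‖A β‖ = ‖A‖ := by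
  obtain ⟨β, hβ, hmax⟩ := (isCompact_sphere (0 : E) 1).exists_isMaxOn
    (NormedSpace.sphere_nonempty.2 zero_le_one) (f := fun x => ‖A x‖) (by fun_prop)
  have hβ1 : ‖β‖ = 1 := by simpa using hβ
  refine ⟨β, hβ, le_antisymm (by simpa [hβ1] using A.le_opNorm β) ?_⟩
  exact A.opNorm_le_of_unit_norm (norm_nonneg _) fun x hx => hmax (by simpa using hx)

/-- The unit sphere is compact, so the supremum of `‖A β‖` is attained and equals the operator norm.
-/
theorem isGradNorm_norm {n : ℕ} (hn : n ≠ 0) {u : EuclideanSpace ℝ (Fin n) → ℝ}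
    {x : EuclideanSpace ℝ (Fin n)} (A : EuclideanSpace ℝ (Fin n) →L[ℝ] F)
    (hA : ∀ β : EuclideanSpace ℝ (Fin n), ‖β‖ = 1 →
      Tendsto (fun t : ℝ => |u (x + t • β) - u x| / t) (𝓝[>] 0) (𝓝 ‖A β‖)) :
    IsGradNorm u x ‖A‖ := by
  have : Nontrivial (EuclideanSpace ℝ (Fin n)) :=
    nontrivial_of_finrank_pos (R := ℝ) (by simpa using Nat.pos_of_ne_zero hn)
  refine ⟨fun β => ‖A β‖, fun β => hA β (by simp), ?_⟩
  obtain ⟨β, hβ, hmax⟩ := A.exists_norm_apply_eq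
  refine IsGreatest.isLUB ⟨⟨⟨β, hβ⟩, hmax⟩, ?_⟩
  rintro _ ⟨γ, rfl⟩
  have hγ : ‖(γ : EuclideanSpace ℝ (Fin n))‖ = 1 := by simp
  simpa [hγ] using A.le_opNorm (γ : EuclideanSpace ℝ (Fin n))

omit [FiniteDimensional ℝ E] in
theorem HasFDerivAt.hasDerivAt_line {h : E → F} {x : E} {h' : E →L[ℝ] F}
    (hh : HasFDerivAt h h' x) (β : E) : HasDerivAt (fun t : ℝ => h (x + t • β)) (h' β) 0 := by
  have hline : HasDerivAt (fun t : ℝ => x + t • β) β 0 := by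
    simpa using ((hasDerivAt_id (0 : ℝ)).smul_const β).const_add x
  exact HasFDerivAt.comp_hasDerivAt 0 (by simpa using hh) hline

omit [FiniteDimensional ℝ E] in
theorem tendsto_abs_norm_sub_div {h : E → F} {x : E} {h' : E →L[ℝ] F}
    (hh : HasFDerivAt h h' x) (hx : h x ≠ 0) (β : E) :
    Tendsto (fun t : ℝ => |‖h (x + t • β)‖ - ‖h x‖| / t) (𝓝[>] 0)
      (𝓝 ‖((innerSL ℝ (‖h x‖⁻¹ • h x)).comp h') β‖) := by
  have hx0 : ‖h x‖ ≠ 0 := norm_ne_zero_iff.2 hx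
  have hd : HasDerivAt (fun t : ℝ => ‖h (x + t • β)‖)
      (((innerSL ℝ (‖h x‖⁻¹ • h x)).comp h') β) 0 := by
    have h1 := ((hh.hasDerivAt_line β).norm_sq).sqrt (by simpa using hx)
    simp only [Real.sqrt_sq (norm_nonneg _), zero_smul, add_zero] at h1
    refine h1.congr_deriv ?_
    simp
    field_simp
  have h2 := hd.tendsto_slope_zero_right.norm
  refine h2.congr' ?_
  filter_upwards [self_mem_nhdsWithin] with t ht
  rw [norm_smul, norm_inv, Real.norm_of_nonneg (le_of_lt ht)]
  simp [div_eq_inv_mul]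

omit [FiniteDimensional ℝ E] in
theorem tendsto_abs_norm_sub_div_of_eq_zero {h : E → F} {x : E} {h' : E →L[ℝ] F}
    (hh : HasFDerivAt h h' x) (hx : h x = 0) (β : E) :
    Tendsto (fun t : ℝ => |‖h (x + t • β)‖ - ‖h x‖| / t) (𝓝[>] 0) (𝓝 ‖h' β‖) := by
  have h2 := (hh.hasDerivAt_line β).tendsto_slope_zero_right.norm
  refine h2.congr' ?_
  filter_upwards [self_mem_nhdsWithin] with t ht
  rw [norm_smul, norm_inv, Real.norm_of_nonneg (le_of_lt ht)]
  simp [div_eq_inv_mul, hx]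

/-- Bounds for the derivatives of the functions `⟨e, h⟩` give a bound for `|∇|h||`. -/
theorem exists_isGradNorm_le {n : ℕ} (hn : n ≠ 0) {h : EuclideanSpace ℝ (Fin n) → F}
    {x : EuclideanSpace ℝ (Fin n)} {h' : EuclideanSpace ℝ (Fin n) →L[ℝ] F}
    (hh : HasFDerivAt h h' x) {B : ℝ} (hB : 0 < B) {P : Prop}
    (hbound : ∀ e : F, ‖e‖ = 1 → ∀ β : EuclideanSpace ℝ (Fin n), ‖β‖ = 1 →
      inner ℝ e (h' β) ≤ B * (1 - inner ℝ e (h x) ^ 2) ∧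
        (P → inner ℝ e (h' β) < B * (1 - inner ℝ e (h x) ^ 2))) :
    ∃ L : ℝ, IsGradNorm (fun y => ‖h y‖) x L ∧ L ≤ B * (1 - ‖h x‖ ^ 2) ∧
      (P → L < B * (1 - ‖h x‖ ^ 2)) := by
  have : Nontrivial (EuclideanSpace ℝ (Fin n)) :=
    nontrivial_of_finrank_pos (R := ℝ) (by simpa using Nat.pos_of_ne_zero hn)
  by_cases hx : h x = 0
  · refine ⟨‖h'‖, isGradNorm_norm hn h' fun β _ => tendsto_abs_norm_sub_div_of_eq_zero hh hx β, ?_⟩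
    obtain ⟨β, hβ, hmax⟩ := h'.exists_norm_apply_eq
    -- If the maximal value of `h'` vanishes, there is no direction to normalize, and the claim is
    -- just `0 < B`.
    by_cases h0 : h' β = 0
    · rw [← hmax, h0, hx]
      simp only [norm_zero, ne_eq, OfNat.ofNat_ne_zero, not_false_eq_true, zero_pow, sub_zero,
        mul_one]
      exact ⟨hB.le, fun _ => hB⟩
    · have hne : ‖h' β‖ ≠ 0 := norm_ne_zero_iff.2 h0
      have hb := hbound (‖h' β‖⁻¹ • h' β) (by rw [norm_smul, norm_inv, norm_norm, inv_mul_cancel₀ hne])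
        β (by simpa using hβ)
      have hi : inner ℝ (‖h' β‖⁻¹ • h' β) (h' β) = ‖h' β‖ := by
        rw [real_inner_smul_left, real_inner_self_eq_norm_sq]
        field_simp
      rw [hi, hx, inner_zero_right, hmax] at hb
      rwa [hx, norm_zero]
  · have hx0 : ‖h x‖ ≠ 0 := norm_ne_zero_iff.2 hx
    set e := ‖h x‖⁻¹ • h x with he
    have he1 : ‖e‖ = 1 := by rw [he, norm_smul, norm_inv, norm_norm, inv_mul_cancel₀ hx0]
    have hex : inner ℝ e (h x) = ‖h x‖ := by
      rw [he, real_inner_smul_left, real_inner_self_eq_norm_sq]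
      field_simp
    refine ⟨‖(innerSL ℝ e).comp h'‖, isGradNorm_norm hn _ fun β _ =>
      tendsto_abs_norm_sub_div hh hx β, ?_⟩
    obtain ⟨β, hβ, hmax⟩ := ((innerSL ℝ e).comp h').exists_norm_apply_eq
    have hβ1 : ‖β‖ = 1 := by simpa using hβ
    rw [← hmax, ← hex]
    simp only [ContinuousLinearMap.comp_apply, innerSL_apply_apply, Real.norm_eq_abs]
    -- The one-sided bound controls the absolute value because it also holds in the direction `-β`.
    rcases abs_choice (inner ℝ e (h' β)) with hs | hs
    · rw [hs]
      exact hbound e he1 β hβ1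
    · have := hbound e he1 (-β) (by rwa [norm_neg])
      rw [map_neg, inner_neg_right] at this
      rwa [hs]

end GradNorm

/-! ### Assembly: components `⟨e, h⟩` of a vector-valued solution. -/

theorem sum_smul_fderiv_single {n : ℕ} {F : Type*} [NormedAddCommGroup F] [NormedSpace ℝ F]
    (L : EuclideanSpace ℝ (Fin n) →L[ℝ] F) (x : EuclideanSpace ℝ (Fin n)) :
    ∑ i : Fin n, x i • L (EuclideanSpace.single i (1 : ℝ)) = L x := by
  conv_rhs => rw [← (EuclideanSpace.basisFun (Fin n) ℝ).sum_repr x]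
  simp

theorem mainTheorem9 (n m : ℕ) (hn : 3 ≤ n) (hm : 1 ≤ m)
    (h : EuclideanSpace ℝ (Fin n) → EuclideanSpace ℝ (Fin m))
    (hmaps : Set.MapsTo h (ball 0 1) (ball 0 1)) :
    (HarmonicOnNhd h (ball 0 1) →
      ∀ x ∈ ball (0 : EuclideanSpace ℝ (Fin n)) 1,
        ∃ L : ℝ, IsGradNorm (fun y => ‖h y‖) x L ∧
          L ≤ (n : ℝ) / 2 * ((1 - ‖h x‖ ^ 2) / (1 - ‖x‖)) ∧
          (4 ≤ n → L < (n : ℝ) / 2 * ((1 - ‖h x‖ ^ 2) / (1 - ‖x‖)))) ∧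
    (IsHyperbolicHarmonic h →
      ∀ x ∈ ball (0 : EuclideanSpace ℝ (Fin n)) 1,
        ∃ L : ℝ, IsGradNorm (fun y => ‖h y‖) x L ∧
          L ≤ ((n : ℝ) - 1) * ((1 - ‖h x‖ ^ 2) / (1 - ‖x‖ ^ 2)) ∧
          (4 ≤ n → L < ((n : ℝ) - 1) * ((1 - ‖h x‖ ^ 2) / (1 - ‖x‖ ^ 2)))) := by
  have hn' : (3 : ℝ) ≤ n := by exact_mod_cast hn
  have hfr : finrank ℝ (EuclideanSpace ℝ (Fin n)) = n := by simp
  have habs : ∀ e : EuclideanSpace ℝ (Fin m), ‖e‖ = 1 →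
      ∀ y ∈ ball (0 : EuclideanSpace ℝ (Fin n)) 1, |(innerSL ℝ e ∘ h) y| < 1 := by
    intro e he y hy
    have h1 : ‖h y‖ < 1 := by simpa using hmaps hy
    refine (abs_real_inner_le_norm e (h y)).trans_lt ?_
    rwa [he, one_mul]
  have hfd : ContDiffOn ℝ 2 h (ball 0 1) → ∀ y ∈ ball (0 : EuclideanSpace ℝ (Fin n)) 1,
      HasFDerivAt h (fderiv ℝ h y) y := fun hc y hy =>
    ((hc.differentiableOn two_ne_zero y hy).differentiableAt (isOpen_ball.mem_nhds hy)).hasFDerivAt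
  have hfe : ContDiffOn ℝ 2 h (ball 0 1) → ∀ e : EuclideanSpace ℝ (Fin m),
      ∀ y ∈ ball (0 : EuclideanSpace ℝ (Fin n)) 1,
      fderiv ℝ (innerSL ℝ e ∘ h) y = (innerSL ℝ e).comp (fderiv ℝ h y) := fun hc e y hy =>
    ((innerSL ℝ e).hasFDerivAt.comp y (hfd hc y hy)).fderiv
  have hlap : ContDiffOn ℝ 2 h (ball 0 1) → ∀ e : EuclideanSpace ℝ (Fin m),
      ∀ y ∈ ball (0 : EuclideanSpace ℝ (Fin n)) 1,
      Laplacian.laplacian (innerSL ℝ e ∘ h) y = inner ℝ e (Laplacian.laplacian h y) :=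
    fun hc e y hy => (hc.contDiffAt (isOpen_ball.mem_nhds hy)).laplacian_CLM_comp_left
  constructor
  · intro hh x hx
    have hc := hh.contDiffOn
    have hx1 : ‖x‖ < 1 := by simpa using hx
    have hval : (n : ℝ) / 2 * ((1 - ‖h x‖ ^ 2) / (1 - ‖x‖)) =
        (n : ℝ) / 2 / (1 - ‖x‖) * (1 - ‖h x‖ ^ 2) := by ring
    rw [hval]
    refine exists_isGradNorm_le (by omega) (hfd hc x hx)
      (div_pos (by linarith) (by linarith)) fun e he β hβ => ?_
    have hb := fderiv_bound_of_harmonic (by rw [hfr]; exact hn)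
      ((innerSL ℝ e).contDiff.comp_contDiffOn hc) (habs e he) (fun y hy => by
        rw [hlap hc e y hy, (hh y hy).2.self_of_nhds]
        simp) hx hβ
    rw [hfe hc e x hx, hfr] at hb
    exact hb
  · rintro ⟨hc, hh⟩ x hx
    have hx1 : ‖x‖ < 1 := by simpa using hx
    have hval : ((n : ℝ) - 1) * ((1 - ‖h x‖ ^ 2) / (1 - ‖x‖ ^ 2)) =
        ((n : ℝ) - 1) / (1 - ‖x‖ ^ 2) * (1 - ‖h x‖ ^ 2) := by ring
    rw [hval]
    refine exists_isGradNorm_le (by omega) (hfd hc x hx)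
      (div_pos (by linarith) (by nlinarith [norm_nonneg x])) fun e he β hβ => ?_
    have hb := fderiv_bound_of_hyperbolic (by rw [hfr]; exact hn)
      ((innerSL ℝ e).contDiff.comp_contDiffOn hc) (habs e he) (fun y hy => by
        have h1 := congrArg (fun z => (inner ℝ e z : ℝ)) (hh y hy)
        simp only [hypLaplacian, sum_smul_fderiv_single, inner_add_right, inner_smul_right,
          inner_zero_right] at h1
        rw [hlap hc e y hy, hfe hc e y hy, hfr]
        exact h1) hx hβ
    rw [hfe hc e x hx, hfr] at hb
    exact hb
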